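/- For a $d$-polytope $P\subset\mathbb R^d$ let $f_0(P)$, $f_{d-1}(P)$, $f_{0,d-1}(P)$ be its numbers of vertices, facets and vertex-facet incidences, and let the natural guess be $\mathrm{NG}(P)=d\,(f_0(P)+f_{d-1}(P))-f_{0,d-1}(P)$. If the $n$ vertices and $m$ facets of $P$ are labeled, the centered realization space $\mathcal R_C(P)\subset\mathbb R^{d\times(n+m)}$ is the set of pairs $(V,A)$ with $V=(v_1,\dots,v_n)$, $A=(a_1,\dots,a_m)$ such that $Q=\mathrm{conv}(v_1,\dots,v_n)=\{x\in\mathbb R^d: a_j^tx\le 1\text{ for all }j\}$ is a $d$-polytope with distinct vertices $v_i$ and distinct facets $\{x\in Q:a_j^tx=1\}$, and there is an isomorphism of the face lattices of $Q$ and $P$ that respects the labels of vertices and facets. Let $T=\{(\pm1,1,1,0),(\pm1,-1,1,0),(\pm1,0,-1,0)\}\subset\mathbb R^4$ (the vertices of a triangular prism) and put $$P_1=\mathrm{conv}(T\cup\{(1,0,0,\pm1)\}),\qquad P_2=\mathrm{conv}(T\cup\{(0,0,0,\pm1)\}),\qquad P_3=\mathrm{conv}(T\cup\{(2,0,0,\pm1)\}).$$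 These are $4$-polytopes, each with the listed $8$ points as vertices, and with $9$, $10$, $11$ facets respectively. Each arises from a pyramid over a triangular prism by adding one new point: for $P_1$ the point is beyond the prism facet, on the supporting hyperplane of a simplex facet and beneath all other facets; for $P_2$ it is beyond the prism facet and beneath all other facets, so that $P_2$ is a bipyramid over a triangular prism; for $P_3$ it is beyond the prism facet, beyond a simplex facet and beneath all other facets. For every labeled $4$-polytope $P$ combinatorially equivalent to $P_1$ (respectively $P_2$, $P_3$), $P$ has $8$ vertices, $9$ (respectively $10$, $11$) facets and $43$ (respectively $46$, $50$) vertex-facet incidences, and $\mathcal R_C(P)$ is a nonempty smooth (embedded) submanifold of $\mathbb R^{4\times(n+m)}$ with $$\dim\mathcal R_C(P_1)=26>25=\mathrm{NG}(P_1),\quad \dim\mathcal R_C(P_2)=27>26=\mathrm{NG}(P_2),\quad \dim\mathcal R_C(P_3)=27>26=\mathrm{NG}(P_3).$$ -/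

import Mathlib

open scoped ContDiff RealInnerProductSpace

namespace PolytopeRealization

/-! ### Faces, facets, combinatorial equivalence -/

section General

variable {E : Type*} [NormedAddCommGroup E] [NormedSpace ℝ E]

/-- The face lattice of a polytope, ordered by inclusion. The faces are the subsets on which some
linear functional is maximal; the empty face and the whole polytope are included. -/
abbrev Face (P : Set E) : Type _ := {F : Set E // IsExposed ℝ P F}

/-- Two polytopes are combinatorially equivalent if their face lattices are isomorphic. -/
def CombEquiv {E' : Type*} [NormedAddCommGroup E'] [NormedSpace ℝ E'] (P : Set E) (Q : Set E') :
    Prop :=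
  Nonempty (Face P ≃o Face Q)

/-- The facets of a `d`-dimensional polytope in `ℝ^d`: its faces of dimension `d - 1`. -/
def IsFacet {d : ℕ} (P F : Set (EuclideanSpace ℝ (Fin d))) : Prop :=
  IsExposed ℝ P F ∧ F.Nonempty ∧ Module.finrank ℝ (vectorSpan ℝ F) + 1 = d

/-! ### Constructions of polytopes -/

/-- A tetrahedron (`3`-simplex). -/
def IsTetrahedron (S : Set E) : Prop :=
  ∃ t : Fin 4 → E, AffineIndependent ℝ t ∧ S = convexHull ℝ (Set.range t)

/-- A prism over a triangle: the convex hull of a triangle and of a translate of it in a direction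
that is not parallel to the plane of the triangle. -/
def IsTriangularPrism (Q : Set E) : Prop :=
  ∃ (t : Fin 3 → E) (u : E), AffineIndependent ℝ t ∧ u ∉ vectorSpan ℝ (Set.range t) ∧
    Q = convexHull ℝ (Set.range t ∪ Set.range (fun i => t i + u))

/-- `R` is the pyramid with base `Q` and apex `a`. -/
def IsPyramid (R Q : Set E) (a : E) : Prop :=
  a ∉ affineSpan ℝ Q ∧ R = convexHull ℝ (insert a Q)

/-- `P` is a bipyramid over `Q`: the convex hull of `Q` and two points outside the affine hull of
`Q` such that the open segment between them meets the relative interior of `Q`. -/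
def IsBipyramid (P Q : Set E) : Prop :=
  ∃ a b : E, a ∉ affineSpan ℝ Q ∧ (openSegment ℝ a b ∩ intrinsicInterior ℝ Q).Nonempty ∧
    P = convexHull ℝ (Q ∪ {a, b})

/-- `x` lies beneath the facet `F` of `P`: strictly on the same side of the supporting hyperplane
of `F` as `P`. -/
def IsBeneath (P F : Set E) (x : E) : Prop :=
  ∃ (l : E →L[ℝ] ℝ) (c : ℝ), (∀ y ∈ P, l y ≤ c) ∧ F = {y ∈ P | l y = c} ∧ l x < c

/-- `x` lies beyond the facet `F` of `P`: strictly on the other side of the supporting hyperplane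
of `F` than `P`. -/
def IsBeyond (P F : Set E) (x : E) : Prop :=
  ∃ (l : E →L[ℝ] ℝ) (c : ℝ), (∀ y ∈ P, l y ≤ c) ∧ F = {y ∈ P | l y = c} ∧ c < l x

end General

/-- `P` arises from a pyramid over a triangular prism by adding a new point that is beyond the
prism facet, on the supporting hyperplane of a simplex facet, and beneath all other facets. -/
def IsConstructionOne (P : Set (EuclideanSpace ℝ (Fin 4))) : Prop :=
  ∃ (R Q S : Set (EuclideanSpace ℝ (Fin 4))) (a x : EuclideanSpace ℝ (Fin 4)),
    IsTriangularPrism Q ∧ IsPyramid R Q a ∧ IsFacet R S ∧ IsTetrahedron S ∧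
    IsBeyond R Q x ∧ x ∈ affineSpan ℝ S ∧
    (∀ F, IsFacet R F → F ≠ Q → F ≠ S → IsBeneath R F x) ∧
    P = convexHull ℝ (insert x R)

/-- `P` arises from a pyramid over a triangular prism by adding a new point that is beyond the
prism facet and beneath all other facets. -/
def IsConstructionTwo (P : Set (EuclideanSpace ℝ (Fin 4))) : Prop :=
  ∃ (R Q : Set (EuclideanSpace ℝ (Fin 4))) (a x : EuclideanSpace ℝ (Fin 4)),
    IsTriangularPrism Q ∧ IsPyramid R Q a ∧ IsBeyond R Q x ∧
    (∀ F, IsFacet R F → F ≠ Q → IsBeneath R F x) ∧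
    P = convexHull ℝ (insert x R)

/-- `P` arises from a pyramid over a triangular prism by adding a new point that is beyond the
prism facet, beyond a simplex facet, and beneath all other facets. -/
def IsConstructionThree (P : Set (EuclideanSpace ℝ (Fin 4))) : Prop :=
  ∃ (R Q S : Set (EuclideanSpace ℝ (Fin 4))) (a x : EuclideanSpace ℝ (Fin 4)),
    IsTriangularPrism Q ∧ IsPyramid R Q a ∧ IsFacet R S ∧ IsTetrahedron S ∧
    IsBeyond R Q x ∧ IsBeyond R S x ∧
    (∀ F, IsFacet R F → F ≠ Q → F ≠ S → IsBeneath R F x) ∧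
    P = convexHull ℝ (insert x R)

/-! ### Numbers of vertices, facets and incidences; the natural guess -/

section Numbers

variable {d : ℕ} (P : Set (EuclideanSpace ℝ (Fin d)))

/-- The number `f₀` of vertices. -/
noncomputable def numVertices : ℕ := (P.exposedPoints ℝ).ncard

/-- The number `f_{d-1}` of facets. -/
noncomputable def numFacets : ℕ := {F | IsFacet P F}.ncard

/-- The number `f_{0,d-1}` of pairs of a vertex and a facet that contains it. -/
noncomputable def numIncidences : ℕ :=
  {q : EuclideanSpace ℝ (Fin d) × Set (EuclideanSpace ℝ (Fin d)) |
    q.1 ∈ P.exposedPoints ℝ ∧ IsFacet P q.2 ∧ q.1 ∈ q.2}.ncard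

/-- The natural guess `d (f₀ + f_{d-1}) - f_{0,d-1}` (an integer, possibly negative). -/
noncomputable def naturalGuess : ℤ :=
  d * (numVertices P + numFacets P) - numIncidences P

end Numbers

/-! ### Labeled polytopes and the centered realization space -/

/-- A `d`-dimensional polytope in `ℝ^d` with its vertices labeled by `Fin n` and its facets labeled
by `Fin m`. -/
structure LabeledPolytope (d n m : ℕ) where
  /-- the polytope -/
  carrier : Set (EuclideanSpace ℝ (Fin d))
  /-- the labeled vertices -/
  vertex : Fin n → EuclideanSpace ℝ (Fin d)
  /-- the labeled facets -/
  facet : Fin m → Set (EuclideanSpace ℝ (Fin d))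
  carrier_eq : carrier = convexHull ℝ (Set.range vertex)
  full_dim : (interior carrier).Nonempty
  vertex_injective : Function.Injective vertex
  range_vertex : Set.range vertex = carrier.exposedPoints ℝ
  facet_injective : Function.Injective facet
  range_facet : Set.range facet = {F | IsFacet carrier F}

namespace LabeledPolytope

variable {d n m : ℕ}

/-- The `i`-th vertex as an element of the face lattice. -/
def vertexFace (P : LabeledPolytope d n m) (i : Fin n) : Face P.carrier :=
  ⟨{P.vertex i}, mem_exposedPoints_iff_exposed_singleton.1
    (P.range_vertex ▸ Set.mem_range_self i)⟩

/-- The `j`-th facet as an element of the face lattice. -/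
def facetFace (P : LabeledPolytope d n m) (j : Fin m) : Face P.carrier :=
  ⟨P.facet j, (show P.facet j ∈ {F | IsFacet P.carrier F} from
    P.range_facet ▸ Set.mem_range_self j).1⟩

/-- `Q` realizes `P`: there is an isomorphism of the face lattices that respects the labels of the
vertices and of the facets. -/
def Realizes (Q P : LabeledPolytope d n m) : Prop :=
  ∃ e : Face Q.carrier ≃o Face P.carrier,
    (∀ i, e (Q.vertexFace i) = P.vertexFace i) ∧ (∀ j, e (Q.facetFace j) = P.facetFace j)

/-- The centered realization space of `P`: all pairs `(V, A)` such that
`conv V = {y | ⟪A j, y⟫ ≤ 1 for all j}` is a `d`-polytope which, with the vertices labeled by `V`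
and the facets by `A`, realizes `P`. -/
def centeredRealizationSpace (P : LabeledPolytope d n m) :
    Set ((Fin n → EuclideanSpace ℝ (Fin d)) × (Fin m → EuclideanSpace ℝ (Fin d))) :=
  {p | ∃ Q : LabeledPolytope d n m,
    Q.vertex = p.1 ∧
    Q.carrier = {y | ∀ j, ⟪p.2 j, y⟫ ≤ 1} ∧
    (∀ j, Q.facet j = {y ∈ Q.carrier | ⟪p.2 j, y⟫ = 1}) ∧
    Q.Realizes P}

end LabeledPolytope

/-! ### Smooth submanifolds -/

/-- `S` is a (smoothly embedded) `k`-dimensional smooth submanifold of the ambient space `E`: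
around each of its points there is a smooth chart of `E` that turns `S` into a `k`-dimensional
linear subspace. -/
def IsSmoothSubmanifold {E : Type*} [NormedAddCommGroup E] [NormedSpace ℝ E]
    (k : ℕ) (S : Set E) : Prop :=
  ∀ p ∈ S, ∃ (φ : OpenPartialHomeomorph E E) (L : Submodule ℝ E),
    p ∈ φ.source ∧ ContDiffOn ℝ ∞ φ φ.source ∧ ContDiffOn ℝ ∞ φ.symm φ.target ∧
    Module.finrank ℝ L = k ∧ ∀ q ∈ φ.source, q ∈ S ↔ φ q ∈ L

/-! ### The three polytopes -/

/-- The vertices of `P₁`. -/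
noncomputable def vertices₁ : Fin 8 → EuclideanSpace ℝ (Fin 4) :=
  ![!₂[-1, 1, 1, 0], !₂[-1, -1, 1, 0], !₂[-1, 0, -1, 0],
    !₂[1, 1, 1, 0], !₂[1, -1, 1, 0], !₂[1, 0, -1, 0],
    !₂[1, 0, 0, -1], !₂[1, 0, 0, 1]]

/-- The vertices of `P₂`. -/
noncomputable def vertices₂ : Fin 8 → EuclideanSpace ℝ (Fin 4) :=
  ![!₂[-1, 1, 1, 0], !₂[-1, -1, 1, 0], !₂[-1, 0, -1, 0],
    !₂[1, 1, 1, 0], !₂[1, -1, 1, 0], !₂[1, 0, -1, 0],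
    !₂[0, 0, 0, -1], !₂[0, 0, 0, 1]]

/-- The vertices of `P₃`. -/
noncomputable def vertices₃ : Fin 8 → EuclideanSpace ℝ (Fin 4) :=
  ![!₂[-1, 1, 1, 0], !₂[-1, -1, 1, 0], !₂[-1, 0, -1, 0],
    !₂[1, 1, 1, 0], !₂[1, -1, 1, 0], !₂[1, 0, -1, 0],
    !₂[2, 0, 0, -1], !₂[2, 0, 0, 1]]

/-- The polytope `P₁`. -/
noncomputable def P₁ : Set (EuclideanSpace ℝ (Fin 4)) := convexHull ℝ (Set.range vertices₁)

/-- The polytope `P₂`. -/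
noncomputable def P₂ : Set (EuclideanSpace ℝ (Fin 4)) := convexHull ℝ (Set.range vertices₂)

/-- The polytope `P₃`. -/
noncomputable def P₃ : Set (EuclideanSpace ℝ (Fin 4)) := convexHull ℝ (Set.range vertices₃)

end PolytopeRealization

open PolytopeRealization

/-!
The face lattice of a polytope is determined by its vertex-facet incidences: faces correspond to
the sets of vertices that are intersections of facets. The geometric input is
`exists_facet_notMem`: a face that misses a vertex lies in a facet that misses it, which is found
by rotating a supporting hyperplane. It follows that vertices and facets are the atoms and coatoms
of the face lattice (so combinatorially equivalent polytopes have the same incidences,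
`LabeledPolytope.exists_relabeling`) and that a labeled polytope realizes another one if and only
if the incidences agree (`LabeledPolytope.realizes_iff`).

Near any of its points, the centered realization space is the solution set of the incidence
equations `⟪A j, V i⟫ = 1` (`LabeledPolytope.eventually_mem_iff`). Under a small perturbation the
polyhedron `{y | ∀ j, ⟪A j, y⟫ ≤ 1}` stays bounded, and the inequalities tight at one of its points
are still all tight at some vertex of the original polytope. At an extreme point the tight
inequalities have only one common solution, so the extreme point is one of the perturbed vertices.

All three polytopes have six facets that are pyramids over the quadrangles of the prism, one for
each quadrangle and each of the two apices. The lines spanned by the three lateral edges of the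
prism pairwise lie in a plane, but not all in the same plane, so that they are concurrent or
parallel, and therefore one of the incidence equations follows from the others
(`prism_redundancy`). This is why the dimension exceeds
the natural guess by one. The remaining equations have independent differentials: there is an order
of the vertices and facets in which each one satisfies linearly independent equations with respect
to those before it. Linear independence is certified by incidences alone (`IsSeparatingList`), and
the order is found by inspection (`IsElimination`). The inverse function theorem then provides
smooth charts of the expected dimension.
-/

namespace PolytopeRealization

/-! ### Faces of the convex hull of finitely many points -/

section ConvexHullFaces

variable {E : Type*} [NormedAddCommGroup E] [NormedSpace ℝ E] {ι : Type*}

theorem le_on_convexHull {V : ι → E} {l : E →L[ℝ] ℝ} {c : ℝ} (h : ∀ i, l (V i) ≤ c) :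
    ∀ y ∈ convexHull ℝ (Set.range V), l y ≤ c := by
  intro y hy
  have hsub : Set.range V ⊆ {y | l y ≤ c} := by rintro _ ⟨i, rfl⟩; exact h i
  exact convexHull_min hsub (convex_halfSpace_le l.isLinear c) hy

variable [Fintype ι]

theorem mem_convexHull_range_iff (V : ι → E) (y : E) :
    y ∈ convexHull ℝ (Set.range V) ↔
      ∃ w : ι → ℝ, (∀ i, 0 ≤ w i) ∧ ∑ i, w i = 1 ∧ ∑ i, w i • V i = y := by
  constructor
  · intro hy
    have hsub : Set.range V ⊆ (Fintype.linearCombination ℝ V) '' stdSimplex ℝ ι := by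
      classical
      rintro _ ⟨i, rfl⟩
      refine ⟨Pi.single i 1, single_mem_stdSimplex ℝ i, ?_⟩
      simp
    have := convexHull_min hsub ((convex_stdSimplex ℝ ι).linear_image _) hy
    obtain ⟨w, hw, rfl⟩ := this
    exact ⟨w, hw.1, hw.2, by simp [Fintype.linearCombination_apply]⟩
  · rintro ⟨w, h0, h1, rfl⟩
    exact mem_convexHull_of_exists_fintype w V h0 h1 (fun i => Set.mem_range_self i) rfl

/-- The face of a polytope cut out by a valid inequality is spanned by the generators on it. -/
theorem face_eq_convexHull {V : ι → E} {l : E →L[ℝ] ℝ} {c : ℝ} (h : ∀ i, l (V i) ≤ c) :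
    {y ∈ convexHull ℝ (Set.range V) | l y = c} = convexHull ℝ (V '' {i | l (V i) = c}) := by
  classical
  apply Set.Subset.antisymm
  · rintro y ⟨hy, hly⟩
    obtain ⟨w, h0, h1, rfl⟩ := (mem_convexHull_range_iff V y).1 hy
    have hz : ∀ i, w i * (c - l (V i)) = 0 := by
      have hs : ∑ i, w i * (c - l (V i)) = 0 := by
        have : ∑ i, w i * l (V i) = c := by simpa [map_sum] using hly
        simp only [mul_sub, Finset.sum_sub_distrib, ← Finset.sum_mul, h1, this, one_mul, sub_self]
      intro i
      exact (Finset.sum_eq_zero_iff_of_nonneg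
        (fun i _ => mul_nonneg (h0 i) (sub_nonneg.2 (h i)))).1 hs i (Finset.mem_univ i)
    have hw : ∀ i, w i ≠ 0 → l (V i) = c := fun i hi => by
      linarith [(mul_eq_zero.1 (hz i)).resolve_left hi]
    rw [← Finset.sum_filter_of_ne (p := fun i => l (V i) = c) fun i _ hi =>
      hw i fun h0 => hi (by rw [h0, zero_smul])]
    refine (convex_convexHull ℝ _).sum_mem (fun i _ => h0 i) ?_ ?_
    · rw [Finset.sum_filter_of_ne fun i _ hi => hw i hi, h1]
    · intro i hi
      exact subset_convexHull ℝ _ ⟨i, (Finset.mem_filter.1 hi).2, rfl⟩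
  · intro y hy
    refine ⟨convexHull_mono (Set.image_subset_range _ _) hy, ?_⟩
    have hsub : V '' {i | l (V i) = c} ⊆ {y | l y = c} := by rintro _ ⟨i, hi, rfl⟩; exact hi
    exact convexHull_min hsub (convex_hyperplane l.isLinear c) hy

theorem isExposed_of_le {P : Set E} {l : E →L[ℝ] ℝ} {c : ℝ} (h : ∀ y ∈ P, l y ≤ c) :
    IsExposed ℝ P {y ∈ P | l y = c} := by
  rintro ⟨x, hx, hxc⟩
  refine ⟨l, Set.ext fun y => ⟨fun hy => ⟨hy.1, fun z hz => ?_⟩, fun hy => ⟨hy.1, ?_⟩⟩⟩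
  · rw [hy.2]; exact h z hz
  · exact le_antisymm (h y hy.1) (hxc ▸ hy.2 x hx)

/-- Every face, including the empty face and the whole set, is cut out by a valid inequality. -/
theorem IsExposed.exists_functional {P F : Set E} (hF : IsExposed ℝ P F) :
    ∃ (l : E →L[ℝ] ℝ) (c : ℝ), (∀ y ∈ P, l y ≤ c) ∧ F = {y ∈ P | l y = c} := by
  rcases F.eq_empty_or_nonempty with rfl | hne
  · refine ⟨0, 1, by simp, ?_⟩
    ext y; simp
  · obtain ⟨l, hl⟩ := hF hne
    obtain ⟨x, hx⟩ := hne
    have hx' := hl ▸ hx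
    refine ⟨l, l x, hx'.2, ?_⟩
    rw [hl]
    ext y
    exact ⟨fun hy => ⟨hy.1, le_antisymm (hx'.2 y hy.1) (hy.2 x hx'.1)⟩,
      fun hy => ⟨hy.1, fun z hz => hy.2 ▸ hx'.2 z hz⟩⟩

theorem IsExposed.eq_convexHull {V : ι → E} {F : Set E}
    (hF : IsExposed ℝ (convexHull ℝ (Set.range V)) F) :
    F = convexHull ℝ (V '' {i | V i ∈ F}) := by
  obtain ⟨l, c, hle, hFe⟩ := IsExposed.exists_functional hF
  have h : ∀ i, l (V i) ≤ c := fun i => hle _ (subset_convexHull ℝ _ ⟨i, rfl⟩)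
  have hset : {i | V i ∈ F} = {i | l (V i) = c} := by
    ext i
    rw [hFe]
    exact ⟨fun hi => hi.2, fun hi => ⟨subset_convexHull ℝ _ ⟨i, rfl⟩, hi⟩⟩
  rw [hset, ← face_eq_convexHull h]
  exact hFe

theorem IsExposed.subset_of_vertices {V : ι → E} {F G : Set E}
    (hF : IsExposed ℝ (convexHull ℝ (Set.range V)) F)
    (hG : IsExposed ℝ (convexHull ℝ (Set.range V)) G) (h : ∀ i, V i ∈ F → V i ∈ G) :
    F ⊆ G := by
  rw [IsExposed.eq_convexHull hF, IsExposed.eq_convexHull hG]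
  exact convexHull_mono (Set.image_mono fun i hi => h i hi)

theorem IsExposed.exists_vertex {V : ι → E} {F : Set E}
    (hF : IsExposed ℝ (convexHull ℝ (Set.range V)) F) (hne : F.Nonempty) : ∃ i, V i ∈ F := by
  rw [IsExposed.eq_convexHull hF] at hne
  obtain ⟨_, i, hi, -⟩ := convexHull_nonempty_iff.1 hne
  exact ⟨i, hi⟩

/-- A functional that is constant on a set with interior points vanishes. -/
theorem functional_eq_zero_of_const {P : Set E} (hP : (interior P).Nonempty) {l : E →L[ℝ] ℝ}
    {c : ℝ} (h : ∀ y ∈ P, l y = c) : l = 0 := by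
  obtain ⟨x, hx⟩ := hP
  have hloc : ∀ᶠ y in nhds x, l y = c := by
    filter_upwards [mem_interior_iff_mem_nhds.1 hx] with y hy using h y hy
  have h1 : HasFDerivAt (fun y => l y) (0 : E →L[ℝ] ℝ) x :=
    (hasFDerivAt_const c x).congr_of_eventuallyEq hloc
  exact l.hasFDerivAt.unique h1

end ConvexHullFaces

/-! ### Facets -/

section Facets

variable {d : ℕ} {ι : Type*} [Fintype ι]

theorem vectorSpan_le_ker {F : Set (EuclideanSpace ℝ (Fin d))}
    {l : EuclideanSpace ℝ (Fin d) →L[ℝ] ℝ} {c : ℝ} (h : ∀ y ∈ F, l y = c) :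
    vectorSpan ℝ F ≤ l.toLinearMap.ker := by
  rw [vectorSpan, Submodule.span_le]
  rintro _ ⟨x, hx, y, hy, rfl⟩
  simp [h x hx, h y hy]

theorem finrank_ker_functional {l : EuclideanSpace ℝ (Fin d) →L[ℝ] ℝ} (hl : l ≠ 0) :
    Module.finrank ℝ l.toLinearMap.ker + 1 = d := by
  have h1 := LinearMap.finrank_range_add_finrank_ker l.toLinearMap
  have h2 : Module.finrank ℝ l.toLinearMap.range = 1 := by
    rw [LinearMap.range_eq_top.2 (LinearMap.surjective (by
      intro h; exact hl (ContinuousLinearMap.coe_injective h)))]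
    simp
  rw [finrank_euclideanSpace_fin] at h1
  omega

/-- A facet contains every point of the polytope that lies in a hyperplane through the facet. -/
theorem IsFacet.eq_of_subset {P F G : Set (EuclideanSpace ℝ (Fin d))} (hF : IsFacet P F)
    (hG : G ⊆ P) (hFG : F ⊆ G) {l : EuclideanSpace ℝ (Fin d) →L[ℝ] ℝ} {c : ℝ} (hl : l ≠ 0)
    (h : ∀ y ∈ G, l y = c) : F = G := by
  refine Set.Subset.antisymm hFG fun y hy => ?_
  obtain ⟨hexp, ⟨x, hx⟩, hdim⟩ := hF
  have hle : vectorSpan ℝ F ≤ l.toLinearMap.ker := vectorSpan_le_ker fun y hy => h y (hFG hy)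
  have heq : vectorSpan ℝ F = l.toLinearMap.ker :=
    Submodule.eq_of_le_of_finrank_eq hle (by have := finrank_ker_functional hl; omega)
  have hyx : y - x ∈ vectorSpan ℝ F := by
    rw [heq]; simp [h y hy, h x (hFG hx)]
  obtain ⟨l', c', -, hF'⟩ := IsExposed.exists_functional hexp
  have hk := vectorSpan_le_ker (F := F) (l := l') (c := c')
    (fun y hy => by rw [hF'] at hy; exact hy.2) hyx
  have hx' : l' x = c' := by rw [hF'] at hx; exact hx.2
  rw [hF']
  refine ⟨hG hy, ?_⟩
  have : l' y - l' x = 0 := by simpa using hk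
  linarith

theorem exists_functional_of_vectorSpan_ne_top {s : Set (EuclideanSpace ℝ (Fin d))}
    {x : EuclideanSpace ℝ (Fin d)} (hx : x ∈ s) (hs : vectorSpan ℝ s ≠ ⊤) :
    ∃ l : EuclideanSpace ℝ (Fin d) →L[ℝ] ℝ, l ≠ 0 ∧ ∀ y ∈ s, l y = l x := by
  obtain ⟨f, hf, hle⟩ := Submodule.exists_le_ker_of_lt_top _ (lt_top_iff_ne_top.2 hs)
  refine ⟨LinearMap.toContinuousLinearMap f, fun h => hf ?_, fun y hy => ?_⟩
  · ext z
    have := congrArg (fun g : EuclideanSpace ℝ (Fin d) →L[ℝ] ℝ => g z) h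
    simpa using this
  · have := hle (vsub_mem_vectorSpan ℝ hy hx)
    have h2 : f y - f x = 0 := by simpa using this
    simpa using sub_eq_zero.1 h2

/-- Rotating a valid inequality of a full-dimensional polytope about the points at which it is
tight, while keeping the slack at a given generator, makes it tight at more points as long as
those points together with the given generator do not affinely span the space. -/
theorem exists_rotated_functional {V : ι → EuclideanSpace ℝ (Fin d)}
    (hint : (interior (convexHull ℝ (Set.range V))).Nonempty)
    {l : EuclideanSpace ℝ (Fin d) →L[ℝ] ℝ} {c : ℝ} (h : ∀ i, l (V i) ≤ c) {i₀ : ι}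
    (hi₀ : l (V i₀) < c)
    (hs : vectorSpan ℝ (insert (V i₀) (V '' {i | l (V i) = c})) ≠ ⊤) :
    ∃ (l' : EuclideanSpace ℝ (Fin d) →L[ℝ] ℝ) (c' : ℝ), (∀ i, l' (V i) ≤ c') ∧ l' (V i₀) < c' ∧
      {i | l (V i) = c} ⊂ {i | l' (V i) = c'} := by
  obtain ⟨m, hm0, hm⟩ := exists_functional_of_vectorSpan_ne_top (Set.mem_insert _ _) hs
  -- Up to sign, some generator lies strictly above the level of `m` on the pivot points.
  obtain ⟨m, hm, w, hw⟩ : ∃ m : EuclideanSpace ℝ (Fin d) →L[ℝ] ℝ,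
      (∀ y ∈ insert (V i₀) (V '' {i | l (V i) = c}), m y = m (V i₀)) ∧
        ∃ w, m (V i₀) < m (V w) := by
    by_contra! hcon
    have h1 := hcon m hm
    have h2 := hcon (-m) (fun y hy => by simp [hm y hy])
    refine hm0 (functional_eq_zero_of_const hint (c := m (V i₀)) fun y hy => ?_)
    refine le_antisymm (le_on_convexHull h1 y hy) ?_
    have := le_on_convexHull h2 y hy
    simpa using this
  -- The rotation stops at the first generator that becomes tight.
  classical
  let S : Finset ι := {i | m (V i₀) < m (V i)}
  have hS : S.Nonempty := ⟨w, by simp [S, hw]⟩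
  obtain ⟨k, hk, hmin⟩ := S.exists_min_image
    (fun i => (c - l (V i)) / (m (V i) - m (V i₀))) hS
  have hk' : m (V i₀) < m (V k) := by simpa [S] using hk
  set t := (c - l (V k)) / (m (V k) - m (V i₀)) with ht
  have ht0 : 0 ≤ t := div_nonneg (sub_nonneg.2 (h k)) (by linarith)
  have hlin : ∀ i, (l + t • m) (V i) = l (V i) + t * m (V i) := fun i => by simp
  refine ⟨l + t • m, c + t * m (V i₀), fun i => ?_, ?_, ?_⟩
  · rw [hlin]
    by_cases hi : m (V i₀) < m (V i)
    · have := hmin i (by simp [S, hi])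
      rw [le_div_iff₀ (by linarith)] at this
      linarith
    · have := mul_le_mul_of_nonneg_left (not_lt.1 hi) ht0
      have := h i
      linarith
  · rw [hlin]; linarith
  · refine (Set.ssubset_iff_of_subset ?_).2 ⟨k, ?_, ?_⟩
    · intro i hi
      have := hm (V i) (Set.mem_insert_of_mem _ ⟨i, hi, rfl⟩)
      simp only [Set.mem_ofPred_eq] at hi ⊢
      rw [hlin, hi, this]
    · simp only [Set.mem_ofPred_eq]
      rw [hlin]
      have : t * (m (V k) - m (V i₀)) = c - l (V k) := by
        rw [ht]; field_simp [(sub_pos.2 hk').ne']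
      linarith
    · intro hi
      have := hm (V k) (Set.mem_insert_of_mem _ ⟨k, hi, rfl⟩)
      linarith

/-- A face of a full-dimensional polytope that misses a vertex is contained in a facet that misses
this vertex. -/
theorem exists_facet_notMem (hd : 0 < d) {V : ι → EuclideanSpace ℝ (Fin d)}
    (hint : (interior (convexHull ℝ (Set.range V))).Nonempty) {F : Set (EuclideanSpace ℝ (Fin d))}
    (hF : IsExposed ℝ (convexHull ℝ (Set.range V)) F) {i₀ : ι} (hi₀ : V i₀ ∉ F) :
    ∃ G, IsFacet (convexHull ℝ (Set.range V)) G ∧ F ⊆ G ∧ V i₀ ∉ G := by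
  -- Among the faces that contain `F` and miss `V i₀`, one with as many vertices as possible is a
  -- facet.
  classical
  set P := convexHull ℝ (Set.range V)
  have hVP : ∀ i, V i ∈ P := fun i => subset_convexHull ℝ _ ⟨i, rfl⟩
  let good : Set (Set ι) := {Z | ∃ (l : EuclideanSpace ℝ (Fin d) →L[ℝ] ℝ) (c : ℝ),
    (∀ i, l (V i) ≤ c) ∧ l (V i₀) < c ∧ Z = {i | l (V i) = c} ∧ {i | V i ∈ F} ⊆ Z}
  have hne : good.Nonempty := by
    obtain ⟨l, c, hle, hFe⟩ := IsExposed.exists_functional hF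
    refine ⟨{i | l (V i) = c}, l, c, fun i => hle _ (hVP i), lt_of_le_of_ne (hle _ (hVP i₀)) ?_,
      rfl, fun i hi => ?_⟩
    · intro h; exact hi₀ (hFe ▸ ⟨hVP i₀, h⟩)
    · have : V i ∈ {y ∈ P | l y = c} := hFe ▸ hi
      exact this.2
  obtain ⟨Z, ⟨l, c, hle, hlt, hZ, hFZ⟩, hmax⟩ := (Set.toFinite good).exists_maximal hne
  have hleP := le_on_convexHull hle
  have hspan : vectorSpan ℝ (insert (V i₀) (V '' {i | l (V i) = c})) = ⊤ := by
    by_contra hs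
    obtain ⟨l', c', h1, h2, h3⟩ := exists_rotated_functional hint hle hlt hs
    have := hmax (y := {i | l' (V i) = c'}) ⟨l', c', h1, h2, rfl,
      hFZ.trans (hZ ▸ h3.subset)⟩ (hZ ▸ h3.subset)
    exact h3.2 (hZ ▸ this)
  have hdim : d ≤ Module.finrank ℝ (vectorSpan ℝ (V '' {i | l (V i) = c})) + 1 := by
    have := finrank_vectorSpan_insert_le_set ℝ (V '' {i | l (V i) = c}) (V i₀)
    rw [hspan, finrank_top, finrank_euclideanSpace_fin] at this
    exact this
  have hZne : {i | l (V i) = c}.Nonempty := by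
    by_contra h
    rw [Set.not_nonempty_iff_eq_empty] at h
    rw [h] at hspan
    have : Module.finrank ℝ (⊤ : Submodule ℝ (EuclideanSpace ℝ (Fin d))) = 0 := by
      rw [← hspan]; simp
    rw [finrank_top, finrank_euclideanSpace_fin] at this
    omega
  have hl0 : l ≠ 0 := by
    rintro rfl
    obtain ⟨i, hi⟩ := hZne
    simp at hi hlt
    linarith
  refine ⟨{y ∈ P | l y = c}, ⟨isExposed_of_le hleP, ?_, ?_⟩, ?_, ?_⟩
  · obtain ⟨i, hi⟩ := hZne
    exact ⟨V i, hVP i, hi⟩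
  · have h1 : vectorSpan ℝ (V '' {i | l (V i) = c}) ≤ vectorSpan ℝ {y ∈ P | l y = c} :=
      vectorSpan_mono ℝ (by rintro _ ⟨i, hi, rfl⟩; exact ⟨hVP i, hi⟩)
    have h2 := Submodule.finrank_mono h1
    have h3 := Submodule.finrank_mono (vectorSpan_le_ker (F := {y ∈ P | l y = c}) (l := l) (c := c)
      fun y hy => hy.2)
    have h4 := finrank_ker_functional hl0
    omega
  · refine IsExposed.subset_of_vertices hF (isExposed_of_le hleP) fun i hi => ⟨hVP i, ?_⟩
    have := hFZ hi
    rw [hZ] at this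
    exact this
  · rintro ⟨-, h⟩
    exact hlt.ne h

theorem IsFacet.exists_functional {P F : Set (EuclideanSpace ℝ (Fin d))} (hF : IsFacet P F)
    (hint : (interior P).Nonempty) :
    ∃ (l : EuclideanSpace ℝ (Fin d) →L[ℝ] ℝ) (c : ℝ),
      l ≠ 0 ∧ (∀ y ∈ P, l y ≤ c) ∧ F = {y ∈ P | l y = c} := by
  obtain ⟨l, c, hle, hFe⟩ := IsExposed.exists_functional hF.1
  refine ⟨l, c, ?_, hle, hFe⟩
  rintro rfl
  obtain ⟨x, hx⟩ := hF.2.1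
  have hx' : x ∈ {y ∈ P | (0 : EuclideanSpace ℝ (Fin d) →L[ℝ] ℝ) y = c} := hFe ▸ hx
  have hc : c = 0 := by simpa using hx'.2.symm
  have hFP : F = P := by rw [hFe]; ext y; simp [hc]
  have h1 := hF.2.2
  have : vectorSpan ℝ P = ⊤ := by
    by_contra hs
    obtain ⟨l, hl, hconst⟩ := exists_functional_of_vectorSpan_ne_top (hFP ▸ hx) hs
    exact hl (functional_eq_zero_of_const hint hconst)
  rw [hFP, this, finrank_top, finrank_euclideanSpace_fin] at h1
  omega

end Facets

/-! ### Face lattices and vertex-facet incidences of labeled polytopes -/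

instance {E : Type*} [NormedAddCommGroup E] [NormedSpace ℝ E] (P : Set E) :
    BoundedOrder (Face P) where
  top := ⟨P, .refl P⟩
  le_top F := F.2.subset
  bot := ⟨∅, isExposed_empty⟩
  bot_le F := Set.empty_subset F.1

namespace LabeledPolytope

variable {d n m : ℕ} (P : LabeledPolytope d n m)

theorem vertex_mem (i : Fin n) : P.vertex i ∈ P.carrier :=
  P.carrier_eq ▸ subset_convexHull ℝ _ ⟨i, rfl⟩

theorem isFacet_facet (j : Fin m) : IsFacet P.carrier (P.facet j) := by
  have : P.facet j ∈ {F | IsFacet P.carrier F} := P.range_facet ▸ Set.mem_range_self j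
  exact this

theorem exists_facet_eq {F : Set (EuclideanSpace ℝ (Fin d))} (hF : IsFacet P.carrier F) :
    ∃ j, P.facet j = F := by
  have : F ∈ Set.range P.facet := P.range_facet ▸ hF
  exact this

theorem subset_of_vertices {F G : Set (EuclideanSpace ℝ (Fin d))}
    (hF : IsExposed ℝ P.carrier F) (hG : IsExposed ℝ P.carrier G)
    (h : ∀ i, P.vertex i ∈ F → P.vertex i ∈ G) : F ⊆ G := by
  rw [P.carrier_eq] at hF hG
  exact IsExposed.subset_of_vertices hF hG h

theorem exists_vertex_mem {F : Set (EuclideanSpace ℝ (Fin d))} (hF : IsExposed ℝ P.carrier F)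
    (hne : F.Nonempty) : ∃ i, P.vertex i ∈ F := by
  rw [P.carrier_eq] at hF
  exact IsExposed.exists_vertex hF hne

theorem exists_facet_notMem (hd : 0 < d) {F : Set (EuclideanSpace ℝ (Fin d))}
    (hF : IsExposed ℝ P.carrier F) {i : Fin n} (hi : P.vertex i ∉ F) :
    ∃ j, F ⊆ P.facet j ∧ P.vertex i ∉ P.facet j := by
  have h := P.full_dim
  rw [P.carrier_eq] at hF h
  obtain ⟨G, hG, hFG, hiG⟩ := PolytopeRealization.exists_facet_notMem hd h hF hi
  rw [← P.carrier_eq] at hG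
  obtain ⟨j, rfl⟩ := P.exists_facet_eq hG
  exact ⟨j, hFG, hiG⟩

theorem facet_ne_carrier (j : Fin m) : P.facet j ≠ P.carrier := by
  intro h
  obtain ⟨l, c, hl, -, hF⟩ := (P.isFacet_facet j).exists_functional P.full_dim
  rw [h] at hF
  refine hl (functional_eq_zero_of_const P.full_dim (c := c) fun y hy => ?_)
  rw [hF] at hy
  exact hy.2

theorem facet_eq_of_subset {j : Fin m} {F : Set (EuclideanSpace ℝ (Fin d))}
    (hF : IsExposed ℝ P.carrier F) (hne : F ≠ P.carrier) (h : P.facet j ⊆ F) :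
    P.facet j = F := by
  obtain ⟨l, c, hle, hFe⟩ := IsExposed.exists_functional hF
  refine (P.isFacet_facet j).eq_of_subset hF.subset h (l := l) (c := c) ?_ ?_
  · rintro rfl
    obtain ⟨x, hx⟩ := (P.isFacet_facet j).2.1
    have hx' := h hx
    rw [hFe] at hx'
    refine hne ?_
    rw [hFe]
    ext y
    simpa using fun _ => hx'.2
  · intro y hy
    rw [hFe] at hy
    exact hy.2

theorem exists_mem_facet_notMem_facet {j k : Fin m} (hjk : j ≠ k) :
    ∃ i, P.vertex i ∈ P.facet j ∧ P.vertex i ∉ P.facet k := by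
  by_contra! h
  refine hjk (P.facet_injective (P.facet_eq_of_subset (P.isFacet_facet k).1
    (P.facet_ne_carrier k) ?_))
  exact P.subset_of_vertices (P.isFacet_facet j).1 (P.isFacet_facet k).1 h

theorem exists_facet_separating (hd : 0 < d) {i k : Fin n} (hik : i ≠ k) :
    ∃ j, P.vertex i ∈ P.facet j ∧ P.vertex k ∉ P.facet j := by
  obtain ⟨j, h1, h2⟩ := P.exists_facet_notMem hd (P.vertexFace i).2 (i := k)
    (fun h => hik (P.vertex_injective h).symm)
  exact ⟨j, h1 rfl, h2⟩

theorem isAtom_iff (F : Face P.carrier) : IsAtom F ↔ ∃ i, P.vertexFace i = F := by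
  constructor
  · intro hF
    have hne : F.1.Nonempty := by
      rw [Set.nonempty_iff_ne_empty]
      exact fun h => hF.1 (Subtype.ext h)
    obtain ⟨i, hi⟩ := P.exists_vertex_mem F.2 hne
    refine ⟨i, (hF.le_iff_eq ?_).1 ?_⟩
    · intro h
      exact Set.singleton_ne_empty _ (congrArg Subtype.val h)
    · exact Set.singleton_subset_iff.2 hi
  · rintro ⟨i, rfl⟩
    refine ⟨fun h => Set.singleton_ne_empty _ (congrArg Subtype.val h), fun G hG => ?_⟩
    have h1 : G.1 ⊂ {P.vertex i} := hG
    exact Subtype.ext (Set.ssubset_singleton_iff.1 h1)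

theorem isCoatom_iff (hd : 0 < d) (F : Face P.carrier) :
    IsCoatom F ↔ ∃ j, P.facetFace j = F := by
  constructor
  · intro hF
    have hne : F.1 ≠ P.carrier := fun h => hF.1 (Subtype.ext h)
    obtain ⟨i, hi⟩ : ∃ i, P.vertex i ∉ F.1 := by
      by_contra! hall
      exact hne (Set.Subset.antisymm F.2.subset
        (P.subset_of_vertices (.refl _) F.2 fun i _ => hall i))
    obtain ⟨j, hj, -⟩ := P.exists_facet_notMem hd F.2 hi
    refine ⟨j, (hF.le_iff_eq ?_).1 hj⟩
    exact fun h => P.facet_ne_carrier j (congrArg Subtype.val h)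
  · rintro ⟨j, rfl⟩
    refine ⟨fun h => P.facet_ne_carrier j (congrArg Subtype.val h), fun G hG => ?_⟩
    by_contra hne
    have := P.facet_eq_of_subset (j := j) G.2 (fun h => hne (Subtype.ext h)) hG.le
    exact hG.ne (Subtype.ext this)

theorem vertexFace_injective : Function.Injective P.vertexFace := fun _ _ h =>
  P.vertex_injective (Set.singleton_injective (congrArg Subtype.val h))

theorem facetFace_injective : Function.Injective P.facetFace := fun _ _ h =>
  P.facet_injective (congrArg Subtype.val h)

theorem vertexFace_le_facetFace {i : Fin n} {j : Fin m} :
    P.vertexFace i ≤ P.facetFace j ↔ P.vertex i ∈ P.facet j :=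
  Set.singleton_subset_iff

/-- The vertices are in bijection with the atoms of the face lattice. -/
noncomputable def vertexEquiv : Fin n ≃ {F : Face P.carrier // IsAtom F} :=
  Equiv.ofBijective (fun i => ⟨P.vertexFace i, (P.isAtom_iff _).2 ⟨i, rfl⟩⟩)
    ⟨fun _ _ h => P.vertexFace_injective (congrArg Subtype.val h), fun F => by
      obtain ⟨i, hi⟩ := (P.isAtom_iff F.1).1 F.2
      exact ⟨i, Subtype.ext hi⟩⟩

/-- The facets are in bijection with the coatoms of the face lattice. -/
noncomputable def facetEquiv (hd : 0 < d) : Fin m ≃ {F : Face P.carrier // IsCoatom F} :=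
  Equiv.ofBijective (fun j => ⟨P.facetFace j, (P.isCoatom_iff hd _).2 ⟨j, rfl⟩⟩)
    ⟨fun _ _ h => P.facetFace_injective (congrArg Subtype.val h), fun F => by
      obtain ⟨j, hj⟩ := (P.isCoatom_iff hd F.1).1 F.2
      exact ⟨j, Subtype.ext hj⟩⟩

/-- Combinatorially equivalent polytopes have the same vertex-facet incidences up to relabeling. -/
theorem exists_relabeling (hd : 0 < d) {n' m' : ℕ} (Q : LabeledPolytope d n' m')
    (h : CombEquiv P.carrier Q.carrier) :
    ∃ (σ : Fin n ≃ Fin n') (τ : Fin m ≃ Fin m'),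
      ∀ i j, P.vertex i ∈ P.facet j ↔ Q.vertex (σ i) ∈ Q.facet (τ j) := by
  obtain ⟨e⟩ := h
  let ea : {F : Face P.carrier // IsAtom F} ≃ {F : Face Q.carrier // IsAtom F} :=
    e.toEquiv.subtypeEquiv fun F => (e.isAtom_iff F).symm
  let ec : {F : Face P.carrier // IsCoatom F} ≃ {F : Face Q.carrier // IsCoatom F} :=
    e.toEquiv.subtypeEquiv fun F => (e.isCoatom_iff F).symm
  refine ⟨P.vertexEquiv.trans (ea.trans Q.vertexEquiv.symm),
    (P.facetEquiv hd).trans (ec.trans (Q.facetEquiv hd).symm), fun i j => ?_⟩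
  rw [← vertexFace_le_facetFace, ← vertexFace_le_facetFace]
  have h1 : ∀ i, Q.vertexFace ((P.vertexEquiv.trans (ea.trans Q.vertexEquiv.symm)) i) =
      e (P.vertexFace i) := fun i =>
    congrArg Subtype.val (Q.vertexEquiv.apply_symm_apply (ea (P.vertexEquiv i)))
  have h2 : ∀ j, Q.facetFace (((P.facetEquiv hd).trans (ec.trans (Q.facetEquiv hd).symm)) j) =
      e (P.facetFace j) := fun j =>
    congrArg Subtype.val ((Q.facetEquiv hd).apply_symm_apply (ec (P.facetEquiv hd j)))
  rw [h1, h2, e.le_iff_le]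

/-- The intersections of facets, seen as sets of vertices. -/
def IsClosedVertexSet (inc : Fin n → Fin m → Prop) (Z : Set (Fin n)) : Prop :=
  ∀ i, i ∉ Z → ∃ j, (∀ k ∈ Z, inc k j) ∧ ¬ inc i j

/-- The face lattice consists of the vertex sets that are intersections of facets. -/
theorem exists_faceIso (hd : 0 < d) {inc : Fin n → Fin m → Prop}
    (hinc : ∀ i j, P.vertex i ∈ P.facet j ↔ inc i j) :
    ∃ e : Face P.carrier ≃o {Z : Set (Fin n) // IsClosedVertexSet inc Z},
      ∀ F, (e F).1 = {i | P.vertex i ∈ F.1} := by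
  classical
  have hclosed : ∀ F : Face P.carrier, IsClosedVertexSet inc {i | P.vertex i ∈ F.1} := by
    intro F i hi
    obtain ⟨j, h1, h2⟩ := P.exists_facet_notMem hd F.2 hi
    exact ⟨j, fun k hk => (hinc k j).1 (h1 hk), fun h => h2 ((hinc i j).2 h)⟩
  let f : Face P.carrier → {Z : Set (Fin n) // IsClosedVertexSet inc Z} :=
    fun F => ⟨_, hclosed F⟩
  have hle : ∀ F G, f F ≤ f G ↔ F ≤ G := fun F G =>
    ⟨fun h => P.subset_of_vertices F.2 G.2 fun i hi => h hi, fun h i hi => h hi⟩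
  have hsurj : Function.Surjective f := by
    rintro ⟨Z, hZ⟩
    let S : Finset (Set (EuclideanSpace ℝ (Fin d))) :=
      insert P.carrier ((Finset.univ.filter fun j => ∀ k ∈ Z, inc k j).image P.facet)
    have hS : IsExposed ℝ P.carrier (⋂₀ (S : Set (Set (EuclideanSpace ℝ (Fin d))))) := by
      refine IsExposed.sInter ⟨P.carrier, Finset.mem_insert_self _ _⟩ fun F hF => ?_
      rcases Finset.mem_insert.1 hF with rfl | hF
      · exact .refl _
      · obtain ⟨j, -, rfl⟩ := Finset.mem_image.1 hF
        exact (P.isFacet_facet j).1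
    refine ⟨⟨_, hS⟩, Subtype.ext (Set.ext fun i => ?_)⟩
    constructor
    · intro hi
      by_contra hiZ
      obtain ⟨j, h1, h2⟩ := hZ i hiZ
      refine h2 ((hinc i j).1 (hi (P.facet j) ?_))
      exact Finset.mem_coe.2 (Finset.mem_insert_of_mem
        (Finset.mem_image.2 ⟨j, Finset.mem_filter.2 ⟨Finset.mem_univ _, h1⟩, rfl⟩))
    · intro hi F hF
      rcases Finset.mem_insert.1 (Finset.mem_coe.1 hF) with rfl | hF
      · exact P.vertex_mem i
      · obtain ⟨j, hj, rfl⟩ := Finset.mem_image.1 hF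
        exact (hinc i j).2 ((Finset.mem_filter.1 hj).2 i hi)
  have hinj : Function.Injective f := fun F G h =>
    le_antisymm ((hle F G).1 h.le) ((hle G F).1 h.ge)
  exact ⟨⟨Equiv.ofBijective f ⟨hinj, hsurj⟩, fun {F G} => hle F G⟩, fun F => rfl⟩

/-- A labeled polytope realizes another one if and only if they have the same vertex-facet
incidences. -/
theorem realizes_iff (hd : 0 < d) (Q : LabeledPolytope d n m) :
    Q.Realizes P ↔ ∀ i j, Q.vertex i ∈ Q.facet j ↔ P.vertex i ∈ P.facet j := by
  constructor
  · rintro ⟨e, hv, hf⟩ i j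
    rw [← vertexFace_le_facetFace, ← vertexFace_le_facetFace, ← hv, ← hf, e.le_iff_le]
  · intro h
    obtain ⟨eP, hP⟩ := P.exists_faceIso hd (inc := fun i j => P.vertex i ∈ P.facet j)
      fun _ _ => Iff.rfl
    obtain ⟨eQ, hQ⟩ := Q.exists_faceIso hd h
    refine ⟨eQ.trans eP.symm, fun i => ?_, fun j => ?_⟩
    · refine eP.injective (Subtype.ext ?_)
      rw [OrderIso.trans_apply, eP.apply_symm_apply, hP, hQ]
      ext k
      change Q.vertex k = Q.vertex i ↔ P.vertex k = P.vertex i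
      rw [Q.vertex_injective.eq_iff, P.vertex_injective.eq_iff]
    · refine eP.injective (Subtype.ext ?_)
      rw [OrderIso.trans_apply, eP.apply_symm_apply, hP, hQ]
      ext k
      exact h k j

end LabeledPolytope

/-! ### Polytopes given by vertices and inequalities -/

theorem convex_halfspaces {d m : ℕ} (A : Fin m → EuclideanSpace ℝ (Fin d)) (c : Fin m → ℝ) :
    Convex ℝ {y | ∀ j, ⟪A j, y⟫ ≤ c j} := by
  have : {y | ∀ j, ⟪A j, y⟫ ≤ c j} = ⋂ j, {y | innerSL ℝ (A j) y ≤ c j} := by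
    ext y; simp
  rw [this]
  exact convex_iInter fun j => convex_halfSpace_le (innerSL ℝ (A j)).isLinear (c j)

/-- A facet of a polyhedron is cut out by one of the defining inequalities. -/
theorem exists_eq_of_isFacet {d m : ℕ} {A : Fin m → EuclideanSpace ℝ (Fin d)} {c : Fin m → ℝ}
    {F : Set (EuclideanSpace ℝ (Fin d))}
    (hint : ∃ y, ∀ j, ⟪A j, y⟫ < c j)
    (hF : IsFacet {y | ∀ j, ⟪A j, y⟫ ≤ c j} F) :
    ∃ j, F = {y | (∀ k, ⟪A k, y⟫ ≤ c k) ∧ ⟪A j, y⟫ = c j} := by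
  set R := {y | ∀ j, ⟪A j, y⟫ ≤ c j} with hR
  have hRc : Convex ℝ R := convex_halfspaces A c
  have hopen : ∀ y, (∀ j, ⟪A j, y⟫ < c j) → y ∈ interior R := by
    intro y hy
    rw [mem_interior_iff_mem_nhds]
    have : ∀ᶠ z in nhds y, ∀ j, ⟪A j, z⟫ < c j := by
      rw [Filter.eventually_all]
      intro j
      exact (show Continuous fun z => ⟪A j, z⟫ by fun_prop).continuousAt.eventually_lt
        continuousAt_const (hy j)
    filter_upwards [this] with z hz j using (hz j).le
  obtain ⟨y₀, hy₀⟩ := hint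
  obtain ⟨l, b, hl, hle, hFe⟩ := hF.exists_functional ⟨y₀, hopen y₀ hy₀⟩
  have hFc : Convex ℝ F := hF.1.convex hRc
  obtain ⟨j, hj⟩ : ∃ j, ∀ y ∈ F, ⟪A j, y⟫ = c j := by
    by_contra! hcon
    choose z hz hzj using hcon
    have hzR : ∀ j k, ⟪A k, z j⟫ ≤ c k := fun j => hF.1.subset (hz j)
    obtain ⟨x, hx⟩ := hF.2.1
    -- The barycenter of the points `z j` satisfies every inequality strictly.
    obtain ⟨y, hyF, hy⟩ : ∃ y ∈ F, ∀ j, ⟪A j, y⟫ < c j := by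
      rcases isEmpty_or_nonempty (Fin m) with hm | hm
      · exact ⟨x, hx, fun j => (hm.false j).elim⟩
      · have hcard : (0 : ℝ) < Fintype.card (Fin m) := by exact_mod_cast Fintype.card_pos
        refine ⟨∑ j, (Fintype.card (Fin m) : ℝ)⁻¹ • z j, hFc.sum_mem (fun _ _ => by positivity)
          (by simp only [Finset.sum_const, Finset.card_univ, nsmul_eq_mul]
              exact mul_inv_cancel₀ hcard.ne') fun j _ => hz j, fun j => ?_⟩
        rw [inner_sum]
        simp_rw [inner_smul_right]
        rw [← Finset.mul_sum, inv_mul_lt_iff₀ hcard]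
        calc ∑ i, ⟪A j, z i⟫ < ∑ _i : Fin m, c j :=
              Finset.sum_lt_sum (fun i _ => hzR i j)
                ⟨j, Finset.mem_univ _, lt_of_le_of_ne (hzR j j) (hzj j)⟩
          _ = _ := by simp
    have hmem := mem_interior_iff_mem_nhds.1 (hopen y hy)
    have hmax : IsLocalMax (fun y => l y) y := by
      have hyb : l y = b := by rw [hFe] at hyF; exact hyF.2
      filter_upwards [hmem] with z hz
      rw [hyb]
      exact hle z hz
    exact hl (hmax.hasFDerivAt_eq_zero l.hasFDerivAt)
  refine ⟨j, hF.eq_of_subset (fun y hy => hy.1) (fun y hy => ⟨hF.1.subset hy, hj y hy⟩)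
    (l := innerSL ℝ (A j)) (c := c j) ?_ fun y hy => by simpa using hy.2⟩
  intro h0
  obtain ⟨x, hx⟩ := hF.2.1
  have h1 : ∀ z, ⟪A j, z⟫ = 0 := fun z => by
    simpa using congrArg (fun g : EuclideanSpace ℝ (Fin d) →L[ℝ] ℝ => g z) h0
  have h2 := hy₀ j
  have h3 := hj x hx
  rw [h1] at h2 h3
  exact h2.ne h3

/-- The vertices `V` and the inequalities `⟪A j, y⟫ ≤ 1` satisfy the incidence relation `inc`:
they are tight at the incident pairs and strict at the others. -/
structure HasIncidences {d n m : ℕ} (inc : Fin n → Fin m → Prop)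
    (V : Fin n → EuclideanSpace ℝ (Fin d)) (A : Fin m → EuclideanSpace ℝ (Fin d)) : Prop where
  eq : ∀ i j, inc i j → ⟪A j, V i⟫ = 1
  lt : ∀ i j, ¬ inc i j → ⟪A j, V i⟫ < 1

section OfIncidence

variable {d n m : ℕ} {inc : Fin n → Fin m → Prop} {V : Fin n → EuclideanSpace ℝ (Fin d)}
  {A : Fin m → EuclideanSpace ℝ (Fin d)}

theorem HasIncidences.le (h : HasIncidences inc V A) (i : Fin n) (j : Fin m) :
    ⟪A j, V i⟫ ≤ 1 := by
  by_cases hij : inc i j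
  · exact (h.eq i j hij).le
  · exact (h.lt i j hij).le

theorem HasIncidences.iff (h : HasIncidences inc V A) (i : Fin n) (j : Fin m) :
    ⟪A j, V i⟫ = 1 ↔ inc i j :=
  ⟨fun hij => by_contra fun hn => (h.lt i j hn).ne hij, h.eq i j⟩

/-- If the convex hull of `V` is given by the inequalities `⟪A j, y⟫ ≤ 1`, and if the incidences
separate vertices and facets, then these are the vertices and the facets of a labeled polytope.
The facet inequalities are recognized without computing dimensions: each facet is cut out by some
inequality, and no two inequalities have comparable sets of tight vertices. -/
theorem HasIncidences.exists_labeledPolytope (hd : 0 < d) (h : HasIncidences inc V A)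
    (hconv : convexHull ℝ (Set.range V) = {y | ∀ j, ⟪A j, y⟫ ≤ 1})
    (hsep : ∀ i k, i ≠ k → ∃ j, inc i j ∧ ¬ inc k j)
    (hfac : ∀ j k, j ≠ k → ∃ i, inc i j ∧ ¬ inc i k) :
    ∃ Q : LabeledPolytope d n m, Q.vertex = V ∧
      Q.carrier = {y | ∀ j, ⟪A j, y⟫ ≤ 1} ∧
      (∀ j, Q.facet j = {y ∈ Q.carrier | ⟪A j, y⟫ = 1}) ∧
      ∀ i j, Q.vertex i ∈ Q.facet j ↔ inc i j := by
  classical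
  set P := convexHull ℝ (Set.range V) with hP
  have hVP : ∀ i, V i ∈ P := fun i => subset_convexHull ℝ _ ⟨i, rfl⟩
  have hle : ∀ j, ∀ y ∈ P, innerSL ℝ (A j) y ≤ 1 := by
    intro j y hy
    rw [hconv] at hy
    exact hy j
  have hmem : ∀ i j, V i ∈ {y ∈ P | ⟪A j, y⟫ = 1} ↔ inc i j := fun i j =>
    ⟨fun hi => (h.iff i j).1 hi.2, fun hi => ⟨hVP i, h.eq i j hi⟩⟩
  have hexp : ∀ j, IsExposed ℝ P {y ∈ P | ⟪A j, y⟫ = 1} := fun j => isExposed_of_le (hle j)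
  have hint : (interior P).Nonempty := by
    refine ⟨0, ?_⟩
    rw [mem_interior_iff_mem_nhds, hconv]
    have : ∀ᶠ z in nhds (0 : EuclideanSpace ℝ (Fin d)), ∀ j, ⟪A j, z⟫ < 1 := by
      rw [Filter.eventually_all]
      intro j
      exact (show Continuous fun z => ⟪A j, z⟫ by fun_prop).continuousAt.eventually_lt
        continuousAt_const (by simp)
    filter_upwards [this] with z hz j using (hz j).le
  have hinj : Function.Injective V := by
    intro i k hik
    by_contra hne
    obtain ⟨j, h1, h2⟩ := hsep i k hne
    exact (h.lt k j h2).ne (hik ▸ h.eq i j h1)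
  have hfinj : Function.Injective fun j => {y ∈ P | ⟪A j, y⟫ = 1} := by
    intro j k hjk
    by_contra hne
    obtain ⟨i, h1, h2⟩ := hfac j k hne
    have h3 : V i ∈ {y ∈ P | ⟪A k, y⟫ = 1} := by
      have := (hmem i j).2 h1
      simp only at hjk
      rwa [hjk] at this
    exact h2 ((hmem i k).1 h3)
  have hvert : Set.range V = P.exposedPoints ℝ := by
    apply Set.Subset.antisymm
    · rintro _ ⟨i, rfl⟩
      -- The sum of the inequalities that are tight at `V i` is tight at no other vertex.
      let l : EuclideanSpace ℝ (Fin d) →L[ℝ] ℝ := ∑ j with inc i j, innerSL ℝ (A j)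
      have hl : ∀ k, l (V k) = ∑ j with inc i j, ⟪A j, V k⟫ := fun k => by
        simp [l]
      have hli : l (V i) = ∑ j with inc i j, (1 : ℝ) := by
        rw [hl]
        exact Finset.sum_congr rfl fun j hj => h.eq i j (Finset.mem_filter.1 hj).2
      have hlk : ∀ k, l (V k) ≤ l (V i) := fun k => by
        rw [hl, hli]
        exact Finset.sum_le_sum fun j _ => h.le k j
      have hset : {k | l (V k) = l (V i)} = {i} := by
        ext k
        refine ⟨fun hk => ?_, fun hk => by rw [hk]; rfl⟩
        by_contra hne
        obtain ⟨j, h1, h2⟩ := hsep i k (Ne.symm hne)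
        refine (ne_of_lt ?_) hk
        rw [hl, hli]
        exact Finset.sum_lt_sum (fun j _ => h.le k j)
          ⟨j, Finset.mem_filter.2 ⟨Finset.mem_univ _, h1⟩, h.lt k j h2⟩
      rw [mem_exposedPoints_iff_exposed_singleton]
      have h1 := isExposed_of_le (le_on_convexHull hlk)
      rw [face_eq_convexHull hlk, hset] at h1
      simpa using h1
    · exact exposedPoints_subset_extremePoints.trans extremePoints_convexHull_subset
  have hpoly : ∀ F, IsFacet P F → ∃ j, F = {y ∈ P | ⟪A j, y⟫ = 1} := by
    intro F hF
    rw [hconv] at hF ⊢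
    exact exists_eq_of_isFacet (c := fun _ => 1) ⟨0, by simp⟩ hF
  have hproper : ∀ j, ∃ i, V i ∉ {y ∈ P | ⟪A j, y⟫ = 1} := by
    intro j
    by_contra! hall
    have h0 : innerSL ℝ (A j) = 0 := by
      refine functional_eq_zero_of_const hint (c := 1) fun y hy => ?_
      exact (IsExposed.subset_of_vertices (.refl P) (hexp j) (fun i _ => hall i) hy).2
    obtain ⟨x, hx⟩ := hint.mono interior_subset
    obtain ⟨i, -⟩ := IsExposed.exists_vertex (.refl P) ⟨x, hx⟩
    have h1 := (hall i).2
    have h2 : innerSL ℝ (A j) (V i) = 0 := by rw [h0]; rfl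
    rw [innerSL_apply_apply] at h2
    linarith
  have hfacet : ∀ j, IsFacet P {y ∈ P | ⟪A j, y⟫ = 1} := by
    intro j
    obtain ⟨i, hi⟩ := hproper j
    obtain ⟨G, hG, hjG, -⟩ := exists_facet_notMem hd hint (hexp j) hi
    obtain ⟨k, rfl⟩ := hpoly G hG
    rcases eq_or_ne j k with rfl | hne
    · exact hG
    · obtain ⟨i, h1, h2⟩ := hfac j k hne
      exact absurd ((hmem i k).1 (hjG ((hmem i j).2 h1))) h2
  refine ⟨⟨P, V, fun j => {y ∈ P | ⟪A j, y⟫ = 1}, rfl, hint, hinj, hvert, hfinj, ?_⟩, rfl,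
    hconv, fun j => rfl, hmem⟩
  ext F
  constructor
  · rintro ⟨j, rfl⟩
    exact hfacet j
  · intro hF
    obtain ⟨j, rfl⟩ := hpoly F hF
    exact ⟨j, rfl⟩

end OfIncidence

/-! ### Regular level sets are smooth submanifolds -/

/-- A set that near `p` is the zero set of an analytic map with surjective derivative at `p` is
flattened near `p` by a smooth chart of the ambient space. -/
theorem exists_flattening_chart {E F : Type*} [NormedAddCommGroup E] [NormedSpace ℝ E]
    [FiniteDimensional ℝ E] [NormedAddCommGroup F] [NormedSpace ℝ F] [FiniteDimensional ℝ F]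
    {f : E → F} (hf : ContDiff ℝ ω f) {f' : E →L[ℝ] F} {p : E} (hf' : HasFDerivAt f f' p)
    (hsurj : Function.Surjective f') {S : Set E} (hS : ∀ᶠ q in nhds p, q ∈ S ↔ f q = 0) {k : ℕ}
    (hk : Module.finrank ℝ E = Module.finrank ℝ F + k) :
    ∃ (φ : OpenPartialHomeomorph E E) (L : Submodule ℝ E),
      p ∈ φ.source ∧ ContDiffOn ℝ ∞ φ φ.source ∧ ContDiffOn ℝ ∞ φ.symm φ.target ∧
      Module.finrank ℝ L = k ∧ ∀ q ∈ φ.source, q ∈ S ↔ φ q ∈ L := by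
  have := FiniteDimensional.complete ℝ E
  have := FiniteDimensional.complete ℝ F
  obtain ⟨π, hπ⟩ := f'.ker_closedComplemented_of_finiteDimensional_range
  have hker : Module.finrank ℝ f'.ker = k := by
    have h1 := LinearMap.finrank_range_add_finrank_ker f'.toLinearMap
    rw [LinearMap.range_eq_top.2 hsurj, finrank_top] at h1
    have h2 : Module.finrank ℝ f'.ker = Module.finrank ℝ f'.toLinearMap.ker := rfl
    omega
  -- The chart completes `f` by a projection to the kernel of its derivative.
  have hbij : Function.Bijective (f'.prod π) := by
    constructor
    · rw [injective_iff_map_eq_zero]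
      intro x hx
      have h1 : f' x = 0 := congrArg Prod.fst hx
      have h2 : π x = 0 := congrArg Prod.snd hx
      have h3 := hπ ⟨x, h1⟩
      rw [show ((⟨x, h1⟩ : f'.ker) : E) = x from rfl, h2] at h3
      exact (congrArg Subtype.val h3).symm
    · rintro ⟨a, b⟩
      obtain ⟨x, rfl⟩ := hsurj a
      refine ⟨x + ((b - π x : f'.ker) : E), ?_⟩
      have h0 : ∀ z : f'.ker, f' (z : E) = 0 := fun z => z.2
      ext1
      · change f' (x + ((b - π x : f'.ker) : E)) = f' x
        rw [map_add, h0, add_zero]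
      · change π (x + ((b - π x : f'.ker) : E)) = b
        rw [map_add, hπ, add_sub_cancel]
  let e : E ≃L[ℝ] F × f'.ker :=
    (LinearEquiv.ofBijective (f'.prod π).toLinearMap hbij).toContinuousLinearEquiv
  have hg : ContDiff ℝ ω fun x => (f x, π x) := hf.prodMk π.contDiff
  have hg' : HasFDerivAt (fun x => (f x, π x)) (e : E →L[ℝ] F × f'.ker) p :=
    hf'.prodMk π.hasFDerivAt
  let Φ := hg.contDiffAt.toOpenPartialHomeomorph (fun x => (f x, π x)) hg' (by simp)
  have hpΦ : p ∈ Φ.source := hg.contDiffAt.mem_toOpenPartialHomeomorph_source hg' (by simp)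
  have hΦ : ∀ x, Φ x = (f x, π x) := fun _ => rfl
  have hsymm : ContDiffAt ℝ ω Φ.symm (Φ p) := by
    refine Φ.contDiffAt_symm (f₀' := e) (Φ.map_source hpΦ) ?_ ?_
    · rw [Φ.left_inv hpΦ]; exact hg'
    · exact hg.contDiffAt
  have hev : ∀ᶠ q in nhds p, (q ∈ S ↔ f q = 0) ∧ ContDiffAt ℝ ω Φ.symm (Φ q) :=
    hS.and ((Φ.continuousAt hpΦ).eventually (hsymm.eventually (by simp)))
  obtain ⟨U, hU, hUo, hpU⟩ := eventually_nhds_iff.1 hev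
  let ψ := Φ.restrOpen U hUo
  let r : (F × f'.ker) ≃L[ℝ] E := ContinuousLinearEquiv.ofFinrankEq (by
    rw [Module.finrank_prod, hker, hk])
  have hψs : ψ.source = Φ.source ∩ U := Φ.restrOpen_source U hUo
  refine ⟨ψ.trans r.toHomeomorph.toOpenPartialHomeomorph,
    (Submodule.prod ⊥ ⊤ : Submodule ℝ (F × f'.ker)).map r.toLinearEquiv.toLinearMap,
    ?_, ?_, ?_, ?_, ?_⟩
  · simpa [hψs] using ⟨hpΦ, hpU⟩
  · exact ((r.contDiff.comp hg).of_le le_top).contDiffOn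
  · intro y hy
    have hy1 : r.symm y ∈ ψ.target := by simpa using hy
    have hy2 : ψ.symm (r.symm y) ∈ Φ.source ∩ U := hψs ▸ ψ.map_target hy1
    have h1 : Φ (Φ.symm (r.symm y)) = r.symm y := ψ.right_inv hy1
    have h2 := (hU _ hy2.2).2
    rw [show Φ (ψ.symm (r.symm y)) = r.symm y from h1] at h2
    exact ((h2.comp y r.symm.contDiff.contDiffAt).of_le le_top).contDiffWithinAt
  · rw [LinearEquiv.finrank_map_eq]
    rw [← hker]
    refine LinearEquiv.finrank_eq ((LinearEquiv.ofInjective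
      (LinearMap.inr ℝ F f'.ker) LinearMap.inr_injective).trans (LinearEquiv.ofEq _ _ ?_)).symm
    ext ⟨a, b⟩
    simp [Submodule.mem_prod, Prod.ext_iff, eq_comm]
  · intro q hq
    have hq' : q ∈ Φ.source ∩ U := by simpa [hψs] using hq
    rw [(hU q hq'.2).1]
    have h1 : (ψ.trans r.toHomeomorph.toOpenPartialHomeomorph) q = r (f q, π q) := rfl
    rw [h1]
    constructor
    · intro h
      exact Submodule.mem_map_of_mem (by simp [Submodule.mem_prod, h])
    · rintro ⟨x, hx, hxr⟩
      have : x = (f q, π q) := r.injective hxr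
      rw [this] at hx
      exact (Submodule.mem_bot ℝ).1 hx.1

/-! ### Local equations of the realization space -/

section Perturbation

variable {d n m : ℕ}

theorem HasIncidences.range_subset {inc : Fin n → Fin m → Prop}
    {V : Fin n → EuclideanSpace ℝ (Fin d)} {A : Fin m → EuclideanSpace ℝ (Fin d)}
    (h : HasIncidences inc V A) : convexHull ℝ (Set.range V) ⊆ {y | ∀ j, ⟪A j, y⟫ ≤ 1} := by
  refine convexHull_min ?_ (convex_halfspaces A fun _ => 1)
  rintro _ ⟨i, rfl⟩ j
  exact h.le i j

/-- A bounded polyhedron is the convex hull of `V` as soon as the inequalities tight at any of its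
points are all tight at some `V i`: at an extreme point the tight inequalities determine the point,
which therefore is `V i`. -/
theorem HasIncidences.convexHull_eq {inc : Fin n → Fin m → Prop}
    {V : Fin n → EuclideanSpace ℝ (Fin d)} {A : Fin m → EuclideanSpace ℝ (Fin d)}
    (h : HasIncidences inc V A) {C : ℝ} (hC : ∀ y, (∀ j, ⟪A j, y⟫ ≤ 1) → ‖y‖ ≤ C)
    (htight : ∀ y, (∀ j, ⟪A j, y⟫ ≤ 1) → ∃ i, ∀ j, ⟪A j, y⟫ = 1 → inc i j) :
    convexHull ℝ (Set.range V) = {y | ∀ j, ⟪A j, y⟫ ≤ 1} := by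
  refine h.range_subset.antisymm ?_
  set R := {y : EuclideanSpace ℝ (Fin d) | ∀ j, ⟪A j, y⟫ ≤ 1} with hR
  have hconv : Convex ℝ R := convex_halfspaces A fun _ => 1
  have hclosed : IsClosed R := by
    have : R = ⋂ j, {y | ⟪A j, y⟫ ≤ 1} := by ext y; simp [hR]
    rw [this]
    exact isClosed_iInter fun j => isClosed_le (by fun_prop) continuous_const
  have hcomp : IsCompact R :=
    (isCompact_closedBall (0 : EuclideanSpace ℝ (Fin d)) C).of_isClosed_subset hclosed
      fun y hy => by simpa using hC y hy
  have hext : R.extremePoints ℝ ⊆ Set.range V := by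
    intro y hy
    obtain ⟨i, hi⟩ := htight y hy.1
    refine ⟨i, ?_⟩
    by_contra hne
    have hViR : V i ∈ R := fun j => h.le i j
    have hev : ∀ᶠ t : ℝ in nhds 0, ∀ j, ⟪A j, y + t • (V i - y)⟫ ≤ 1 := by
      rw [Filter.eventually_all]
      intro j
      rcases eq_or_lt_of_le (hy.1 j) with hj | hj
      · refine Filter.Eventually.of_forall fun t => ?_
        rw [inner_add_right, inner_smul_right, inner_sub_right, h.eq i j (hi j hj), hj]
        simp
      · have hc : Continuous fun t : ℝ => ⟪A j, y + t • (V i - y)⟫ := by fun_prop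
        have := hc.continuousAt (x := 0) |>.eventually_lt (continuousAt_const (y := (1 : ℝ)))
          (by simpa using hj)
        exact this.mono fun t ht => ht.le
    obtain ⟨ε, hε, hball⟩ := Metric.eventually_nhds_iff.1 hev
    have h2 : y + (-(ε / 2)) • (V i - y) ∈ R := hball (by
      rw [Real.dist_eq, sub_zero, abs_neg, abs_of_pos (by linarith)]; linarith)
    have hseg : y ∈ openSegment ℝ (V i) (y + (-(ε / 2)) • (V i - y)) := by
      refine ⟨(ε / 2) / (1 + ε / 2), 1 / (1 + ε / 2), by positivity, by positivity,
        by field_simp; ring, ?_⟩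
      have hpos : (1 + ε / 2) ≠ 0 := by positivity
      ext k
      simp only [PiLp.add_apply, PiLp.smul_apply, PiLp.sub_apply, smul_eq_mul]
      field_simp
      ring
    exact hne (hy.2 hViR h2 hseg)
  rw [← closure_convexHull_extremePoints hcomp hconv]
  refine closure_minimal (convexHull_mono hext) ?_
  exact (Set.finite_range V).isClosed_convexHull ℝ

/-- Near a realization, the polyhedra `{y | ∀ j, ⟪A j, y⟫ ≤ 1}` stay bounded. -/
theorem eventually_bounded {A : Fin m → EuclideanSpace ℝ (Fin d)} {C : ℝ} (hC0 : 0 < C)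
    (hC : ∀ y, (∀ j, ⟪A j, y⟫ ≤ 1) → ‖y‖ < C) :
    ∀ᶠ B in nhds A, ∀ y, (∀ j, ⟪B j, y⟫ ≤ 1) → ‖y‖ ≤ C := by
  have hev : ∀ᶠ B in nhds A, ∀ y ∈ Metric.sphere (0 : EuclideanSpace ℝ (Fin d)) C,
      ∃ j, 1 < ⟪B j, y⟫ := by
    refine (isCompact_sphere _ C).eventually_forall_of_forall_eventually fun y hy => ?_
    obtain ⟨j, hj⟩ : ∃ j, 1 < ⟪A j, y⟫ := by
      by_contra! hcon
      exact (hC y hcon).ne (by simpa using hy)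
    have hc : Continuous fun z : (Fin m → EuclideanSpace ℝ (Fin d)) × EuclideanSpace ℝ (Fin d) =>
        ⟪z.1 j, z.2⟫ := by fun_prop
    have := (continuousAt_const (y := (1 : ℝ))).eventually_lt (hc.continuousAt (x := (A, y))) hj
    exact this.mono fun z hz => ⟨j, hz⟩
  filter_upwards [hev] with B hB y hy
  by_contra! hlt
  have hy0 : 0 < ‖y‖ := hC0.trans hlt
  obtain ⟨j, hj⟩ := hB ((C / ‖y‖) • y) (by
    rw [mem_sphere_zero_iff_norm, norm_smul, Real.norm_of_nonneg (by positivity)]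
    field_simp)
  rw [inner_smul_right] at hj
  have h1 : C / ‖y‖ ≤ 1 := (div_le_one hy0).2 hlt.le
  have h2 : 0 ≤ C / ‖y‖ := by positivity
  nlinarith [hy j]

/-- At a point of a polytope, the tight inequalities are all tight at some vertex. -/
theorem HasIncidences.exists_vertex_of_mem {inc : Fin n → Fin m → Prop}
    {V : Fin n → EuclideanSpace ℝ (Fin d)} {A : Fin m → EuclideanSpace ℝ (Fin d)}
    (h : HasIncidences inc V A) {y : EuclideanSpace ℝ (Fin d)}
    (hy : y ∈ convexHull ℝ (Set.range V)) : ∃ i, ∀ j, ⟪A j, y⟫ = 1 → inc i j := by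
  obtain ⟨w, h0, h1, rfl⟩ := (mem_convexHull_range_iff V y).1 hy
  obtain ⟨i, -, hi⟩ : ∃ i ∈ Finset.univ, w i ≠ 0 := by
    refine Finset.exists_ne_zero_of_sum_ne_zero ?_
    rw [h1]; exact one_ne_zero
  refine ⟨i, fun j hj => by_contra fun hn => ?_⟩
  rw [inner_sum] at hj
  simp_rw [inner_smul_right] at hj
  have : ∑ k, w k * ⟪A j, V k⟫ < ∑ k, w k * 1 :=
    Finset.sum_lt_sum (fun k _ => mul_le_mul_of_nonneg_left (h.le k j) (h0 k))
      ⟨i, Finset.mem_univ _, mul_lt_mul_of_pos_left (h.lt i j hn)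
        (lt_of_le_of_ne (h0 i) (Ne.symm hi))⟩
  simp only [mul_one, h1] at this
  exact this.ne hj

/-- Near a realization, the inequalities that are tight at a point of the polyhedron are all tight
at some vertex of the polytope. -/
theorem HasIncidences.eventually_exists_vertex {inc : Fin n → Fin m → Prop}
    {V : Fin n → EuclideanSpace ℝ (Fin d)} {A : Fin m → EuclideanSpace ℝ (Fin d)}
    (h : HasIncidences inc V A)
    (hconv : convexHull ℝ (Set.range V) = {y | ∀ j, ⟪A j, y⟫ ≤ 1}) (C : ℝ) :
    ∀ᶠ B in nhds A, ∀ y ∈ Metric.closedBall (0 : EuclideanSpace ℝ (Fin d)) C,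
      (∀ j, ⟪B j, y⟫ ≤ 1) → ∃ i, ∀ j, ⟪B j, y⟫ = 1 → inc i j := by
  refine (isCompact_closedBall _ C).eventually_forall_of_forall_eventually fun y _ => ?_
  have hc : ∀ j, Continuous
      fun z : (Fin m → EuclideanSpace ℝ (Fin d)) × EuclideanSpace ℝ (Fin d) => ⟪z.1 j, z.2⟫ :=
    fun j => by fun_prop
  by_cases hy : ∀ j, ⟪A j, y⟫ ≤ 1
  · obtain ⟨i, hi⟩ := h.exists_vertex_of_mem (y := y) (by rw [hconv]; exact hy)
    have hev : ∀ᶠ z in nhds (A, y), ∀ j, ⟪A j, y⟫ ≠ 1 → ⟪z.1 j, z.2⟫ ≠ 1 := by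
      rw [Filter.eventually_all]
      intro j
      by_cases hj : ⟪A j, y⟫ = 1
      · exact Filter.Eventually.of_forall fun z hz => absurd hj hz
      · exact ((hc j).continuousAt.eventually_ne hj).mono fun z hz _ => hz
    filter_upwards [hev] with z hz _
    exact ⟨i, fun j hj => hi j (by_contra fun hne => hz j hne hj)⟩
  · push Not at hy
    obtain ⟨j, hj⟩ := hy
    have := (continuousAt_const (y := (1 : ℝ))).eventually_lt
      ((hc j).continuousAt (x := (A, y))) hj
    exact this.mono fun z hz hle => absurd (hle j) hz.not_ge

end Perturbation

namespace LabeledPolytope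

variable {d n m : ℕ} (P : LabeledPolytope d n m)

theorem hasIncidences_of_mem (hd : 0 < d)
    {p : (Fin n → EuclideanSpace ℝ (Fin d)) × (Fin m → EuclideanSpace ℝ (Fin d))}
    (hp : p ∈ P.centeredRealizationSpace) :
    HasIncidences (fun i j => P.vertex i ∈ P.facet j) p.1 p.2 ∧
      convexHull ℝ (Set.range p.1) = {y | ∀ j, ⟪p.2 j, y⟫ ≤ 1} := by
  obtain ⟨Q, hv, hc, hf, hr⟩ := hp
  have hinc := (P.realizes_iff hd Q).1 hr
  have hle : ∀ i j, ⟪p.2 j, Q.vertex i⟫ ≤ 1 := fun i j => by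
    have := Q.vertex_mem i
    rw [hc] at this
    exact this j
  refine ⟨⟨fun i j hij => ?_, fun i j hij => ?_⟩, ?_⟩
  · have := (hinc i j).2 hij
    rw [hf] at this
    rw [← hv]; exact this.2
  · rw [← hv]
    refine lt_of_le_of_ne (hle i j) fun h => hij ((hinc i j).1 ?_)
    rw [hf]
    exact ⟨Q.vertex_mem i, h⟩
  · rw [← hc, Q.carrier_eq, hv]

/-- The incidences together with `conv V = {y | ∀ j, ⟪A j, y⟫ ≤ 1}` characterize the points of the
centered realization space. -/
theorem mem_centeredRealizationSpace (hd : 0 < d)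
    {p : (Fin n → EuclideanSpace ℝ (Fin d)) × (Fin m → EuclideanSpace ℝ (Fin d))}
    (h : HasIncidences (fun i j => P.vertex i ∈ P.facet j) p.1 p.2)
    (hconv : convexHull ℝ (Set.range p.1) = {y | ∀ j, ⟪p.2 j, y⟫ ≤ 1}) :
    p ∈ P.centeredRealizationSpace := by
  obtain ⟨Q, hv, hc, hf, hinc⟩ := h.exists_labeledPolytope hd hconv
    (fun i k hik => P.exists_facet_separating hd hik)
    (fun j k hjk => P.exists_mem_facet_notMem_facet hjk)
  exact ⟨Q, hv, hc, hf, (P.realizes_iff hd Q).2 hinc⟩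

/-- Near each of its points, the centered realization space is cut out by the incidence
equations. -/
theorem eventually_mem_iff (hd : 0 < d)
    {p : (Fin n → EuclideanSpace ℝ (Fin d)) × (Fin m → EuclideanSpace ℝ (Fin d))}
    (hp : p ∈ P.centeredRealizationSpace) :
    ∀ᶠ q in nhds p, (∀ i j, P.vertex i ∉ P.facet j → ⟪q.2 j, q.1 i⟫ < 1) ∧
      (q ∈ P.centeredRealizationSpace ↔
        ∀ i j, P.vertex i ∈ P.facet j → ⟪q.2 j, q.1 i⟫ = 1) := by
  obtain ⟨h, hconv⟩ := P.hasIncidences_of_mem hd hp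
  obtain ⟨C, hC0, hC⟩ : ∃ C : ℝ, 0 < C ∧ ∀ y, (∀ j, ⟪p.2 j, y⟫ ≤ 1) → ‖y‖ < C := by
    have hb : Bornology.IsBounded {y | ∀ j, ⟪p.2 j, y⟫ ≤ 1} := by
      rw [← hconv, isBounded_convexHull]
      exact (Set.finite_range _).isBounded
    obtain ⟨C, hC0, hC⟩ := hb.exists_pos_norm_lt
    exact ⟨C, hC0, hC⟩
  have hlt : ∀ᶠ q in nhds p, ∀ i j, P.vertex i ∉ P.facet j → ⟪q.2 j, q.1 i⟫ < 1 := by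
    rw [Filter.eventually_all]
    intro i
    rw [Filter.eventually_all]
    intro j
    by_cases hij : P.vertex i ∈ P.facet j
    · exact Filter.Eventually.of_forall fun q hq => absurd hij hq
    · have hc : Continuous fun q : (Fin n → EuclideanSpace ℝ (Fin d)) ×
          (Fin m → EuclideanSpace ℝ (Fin d)) => ⟪q.2 j, q.1 i⟫ := by fun_prop
      exact (hc.continuousAt.eventually_lt continuousAt_const (h.lt i j hij)).mono
        fun q hq _ => hq
  have hsnd : Filter.Tendsto Prod.snd (nhds p) (nhds p.2) := continuous_snd.continuousAt
  filter_upwards [hlt, hsnd.eventually (eventually_bounded hC0 hC),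
    hsnd.eventually (h.eventually_exists_vertex hconv C)] with q h1 h2 h3
  refine ⟨h1, fun hq => (P.hasIncidences_of_mem hd hq).1.eq, fun heq => ?_⟩
  have hq : HasIncidences (fun i j => P.vertex i ∈ P.facet j) q.1 q.2 := ⟨heq, h1⟩
  exact P.mem_centeredRealizationSpace hd hq (hq.convexHull_eq h2 fun y hy =>
    h3 y (by simpa using h2 y hy) hy)

end LabeledPolytope

/-! ### Solving the linearized incidence equations -/

/-- Each entry of the list is separated from the later ones by some `k`: the later entries are
related to `k` while the entry itself is not. For facets of a polytope through a common vertex, or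
vertices on a common facet, this is a combinatorial certificate of linear independence. -/
def IsSeparatingList {ι κ : Type*} (r : ι → κ → Prop) : List ι → Prop
  | [] => True
  | i :: l => (∃ k, ¬ r i k ∧ ∀ i' ∈ l, r i' k) ∧ IsSeparatingList r l

instance decidableIsSeparatingList {ι κ : Type*} [Fintype κ] (r : ι → κ → Prop)
    [∀ i k, Decidable (r i k)] :
    (l : List ι) → Decidable (IsSeparatingList r l)
  | [] => inferInstanceAs (Decidable True)
  | i :: l =>
    have : Decidable (IsSeparatingList r l) := decidableIsSeparatingList r l
    inferInstanceAs (Decidable ((∃ k, ¬ r i k ∧ ∀ i' ∈ l, r i' k) ∧ IsSeparatingList r l))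

/-- The difference of a separating vector and the common one is orthogonal to the later entries,
so it corrects the equation of the entry without disturbing the later ones. -/
theorem IsSeparatingList.exists_solution {E : Type*} [NormedAddCommGroup E]
    [InnerProductSpace ℝ E] {ι κ : Type*} {r : ι → κ → Prop} {X : ι → E} {Y : κ → E}
    (hr : ∀ i k, ⟪X i, Y k⟫ = 1 ↔ r i k) {k₀ : κ} (t : ι → ℝ) :
    ∀ {l : List ι}, IsSeparatingList r l → (∀ i ∈ l, r i k₀) → ∃ x, ∀ i ∈ l, ⟪X i, x⟫ = t i
  | [], _, _ => ⟨0, by simp⟩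
  | i :: l, ⟨⟨k, hik, hk⟩, hl⟩, h₀ => by
    obtain ⟨x, hx⟩ := IsSeparatingList.exists_solution hr (k₀ := k₀) t hl
      fun i' hi' => h₀ i' (List.mem_cons_of_mem _ hi')
    have hi0 : ⟪X i, Y k₀⟫ = 1 := (hr i k₀).2 (h₀ i List.mem_cons_self)
    have hne : ⟪X i, Y k⟫ - 1 ≠ 0 := sub_ne_zero.2 fun h => hik ((hr i k).1 h)
    refine ⟨x + ((t i - ⟪X i, x⟫) / (⟪X i, Y k⟫ - 1)) • (Y k - Y k₀), fun i' hi' => ?_⟩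
    rw [inner_add_right, inner_smul_right, inner_sub_right]
    rcases List.mem_cons.1 hi' with rfl | hi'
    · rw [hi0, div_mul_cancel₀ _ hne]; ring
    · rw [hx i' hi', (hr i' k).2 (hk i' hi'),
        (hr i' k₀).2 (h₀ i' (List.mem_cons_of_mem _ hi'))]
      ring

/-- The incidences listed in an elimination sequence. An entry of the sequence is a vertex with
some of its facets, or a facet with some of its vertices. -/
def eliminated {n m : ℕ} :
    List ((Fin n × List (Fin m)) ⊕ (Fin m × List (Fin n))) → List (Fin n × Fin m)
  | [] => []
  | .inl (i, l) :: L => l.map (fun j => (i, j)) ++ eliminated L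
  | .inr (j, l) :: L => l.map (fun i => (i, j)) ++ eliminated L

/-- In an elimination sequence each vertex or facet comes with a separating list of incident facets
or vertices, and it does not occur in the incidences that are listed later. The equations can thus
be solved from the end of the sequence to its beginning, one vertex or facet at a time. -/
def IsElimination {n m : ℕ} (inc : Fin n → Fin m → Prop) :
    List ((Fin n × List (Fin m)) ⊕ (Fin m × List (Fin n))) → Prop
  | [] => True
  | .inl (i, l) :: L => ((∀ j ∈ l, inc i j) ∧ IsSeparatingList (fun j i => inc i j) l ∧
      ∀ q ∈ eliminated L, q.1 ≠ i) ∧ IsElimination inc L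
  | .inr (j, l) :: L => ((∀ i ∈ l, inc i j) ∧ IsSeparatingList inc l ∧
      ∀ q ∈ eliminated L, q.2 ≠ j) ∧ IsElimination inc L

instance decidableIsElimination {n m : ℕ} (inc : Fin n → Fin m → Prop)
    [∀ i j, Decidable (inc i j)] :
    (L : List ((Fin n × List (Fin m)) ⊕ (Fin m × List (Fin n)))) → Decidable (IsElimination inc L)
  | [] => inferInstanceAs (Decidable True)
  | .inl (i, l) :: L =>
    have : Decidable (IsElimination inc L) := decidableIsElimination inc L
    inferInstanceAs (Decidable (((∀ j ∈ l, inc i j) ∧ IsSeparatingList (fun j i => inc i j) l ∧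
      ∀ q ∈ eliminated L, q.1 ≠ i) ∧ IsElimination inc L))
  | .inr (j, l) :: L =>
    have : Decidable (IsElimination inc L) := decidableIsElimination inc L
    inferInstanceAs (Decidable (((∀ i ∈ l, inc i j) ∧ IsSeparatingList inc l ∧
      ∀ q ∈ eliminated L, q.2 ≠ j) ∧ IsElimination inc L))

/-- The linearized incidence equations of an elimination sequence are solvable for arbitrary
right-hand sides. -/
theorem HasIncidences.exists_linearized_solution {d n m : ℕ} {inc : Fin n → Fin m → Prop}
    {V : Fin n → EuclideanSpace ℝ (Fin d)} {A : Fin m → EuclideanSpace ℝ (Fin d)}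
    (h : HasIncidences inc V A) (t : Fin n → Fin m → ℝ) :
    ∀ {L : List ((Fin n × List (Fin m)) ⊕ (Fin m × List (Fin n)))}, IsElimination inc L →
      ∃ (v : Fin n → EuclideanSpace ℝ (Fin d)) (a : Fin m → EuclideanSpace ℝ (Fin d)),
        ∀ q ∈ eliminated L, ⟪A q.2, v q.1⟫ + ⟪a q.2, V q.1⟫ = t q.1 q.2
  | [], _ => ⟨0, 0, by simp [eliminated]⟩
  | .inl (i, l) :: L, ⟨⟨hinc, hsep, hnew⟩, hL⟩ => by
    obtain ⟨v, a, hva⟩ := h.exists_linearized_solution t hL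
    obtain ⟨x, hx⟩ := hsep.exists_solution (X := A) (Y := V) (fun j i => h.iff i j) (k₀ := i)
      (fun j => t i j - ⟪a j, V i⟫) hinc
    refine ⟨Function.update v i x, a, fun q hq => ?_⟩
    rcases List.mem_append.1 hq with hq | hq
    · obtain ⟨j, hj, rfl⟩ := List.mem_map.1 hq
      simp [hx j hj]
    · rw [Function.update_of_ne (hnew q hq)]
      exact hva q hq
  | .inr (j, l) :: L, ⟨⟨hinc, hsep, hnew⟩, hL⟩ => by
    obtain ⟨v, a, hva⟩ := h.exists_linearized_solution t hL
    obtain ⟨x, hx⟩ := hsep.exists_solution (X := V) (Y := A)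
      (fun i j => by rw [real_inner_comm]; exact h.iff i j) (k₀ := j)
      (fun i => t i j - ⟪A j, v i⟫) hinc
    refine ⟨v, Function.update a j x, fun q hq => ?_⟩
    rcases List.mem_append.1 hq with hq | hq
    · obtain ⟨i, hi, rfl⟩ := List.mem_map.1 hq
      simp [real_inner_comm _ x, hx i hi]
    · rw [Function.update_of_ne (hnew q hq)]
      exact hva q hq

/-- If all incidence equations but one can be eliminated, and the remaining one follows from the
others near the realization space, then the realization space is a smooth submanifold and its
codimension is one less than the number of incidences. -/
theorem LabeledPolytope.isSmoothSubmanifold {d n m n' m' : ℕ} (hd : 0 < d)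
    (P : LabeledPolytope d n m) {inc : Fin n' → Fin m' → Prop} [∀ i j, Decidable (inc i j)]
    (σ : Fin n ≃ Fin n') (τ : Fin m ≃ Fin m')
    (hinc : ∀ i j, P.vertex i ∈ P.facet j ↔ inc (σ i) (τ j)) {q₀ : Fin n' × Fin m'}
    {L : List ((Fin n' × List (Fin m')) ⊕ (Fin m' × List (Fin n')))} (hL : IsElimination inc L)
    (hcov : ∀ q : Fin n' × Fin m', inc q.1 q.2 → q ≠ q₀ → q ∈ eliminated L)
    (hred : ∀ (V : Fin n' → EuclideanSpace ℝ (Fin d)) (A : Fin m' → EuclideanSpace ℝ (Fin d)),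
      (∀ q : Fin n' × Fin m', inc q.1 q.2 → q ≠ q₀ → ⟪A q.2, V q.1⟫ = 1) →
      (∀ i j, ¬ inc i j → ⟪A j, V i⟫ < 1) → ⟪A q₀.2, V q₀.1⟫ = 1) {k : ℕ}
    (hk : d * (n' + m') =
      Fintype.card {q : Fin n' × Fin m' // inc q.1 q.2 ∧ q ≠ q₀} + k) :
    IsSmoothSubmanifold k P.centeredRealizationSpace := by
  intro p hp
  let ι := {q : Fin n' × Fin m' // inc q.1 q.2 ∧ q ≠ q₀}
  let X := (Fin n → EuclideanSpace ℝ (Fin d)) × (Fin m → EuclideanSpace ℝ (Fin d))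
  let B : ι → X →L[ℝ] EuclideanSpace ℝ (Fin d) := fun s =>
    (ContinuousLinearMap.proj (τ.symm s.1.2)).comp (ContinuousLinearMap.snd ℝ _ _)
  let C : ι → X →L[ℝ] EuclideanSpace ℝ (Fin d) := fun s =>
    (ContinuousLinearMap.proj (σ.symm s.1.1)).comp (ContinuousLinearMap.fst ℝ _ _)
  let f : X → ι → ℝ := fun q s => ⟪B s q, C s q⟫ - 1
  have hf : ContDiff ℝ ω f :=
    contDiff_pi.2 fun s => ((B s).contDiff.inner ℝ (C s).contDiff).sub contDiff_const
  have hf' : HasFDerivAt f (fderiv ℝ f p) p :=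
    (hf.differentiable (by simp)).differentiableAt.hasFDerivAt
  have hval : ∀ (w : X) (s : ι), fderiv ℝ f p w s =
      ⟪p.2 (τ.symm s.1.2), w.1 (σ.symm s.1.1)⟫ + ⟪w.2 (τ.symm s.1.2), p.1 (σ.symm s.1.1)⟫ := by
    intro w s
    have h1 := hasFDerivAt_pi'.1 hf' s
    have h2 := (((B s).hasFDerivAt (x := p)).inner ℝ ((C s).hasFDerivAt (x := p))).sub_const 1
    exact (congrArg (fun g : X →L[ℝ] ℝ => g w) (h1.unique h2)).trans
      (fderivInnerCLM_apply ℝ _ _)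
  have hp' := (P.hasIncidences_of_mem hd hp).1
  have hpm : HasIncidences inc (p.1 ∘ σ.symm) (p.2 ∘ τ.symm) :=
    ⟨fun i j hij => hp'.eq _ _ ((hinc _ _).2 (by simpa using hij)),
      fun i j hij => hp'.lt _ _ fun h => hij (by simpa using (hinc _ _).1 h)⟩
  refine exists_flattening_chart hf hf' ?_ ?_ (k := k) ?_
  · intro t
    obtain ⟨v, a, hva⟩ := hpm.exists_linearized_solution
      (fun i j => if h : inc i j ∧ (i, j) ≠ q₀ then t ⟨(i, j), h⟩ else 0) hL
    refine ⟨(v ∘ σ, a ∘ τ), funext fun s => ?_⟩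
    rw [hval]
    have := hva s.1 (hcov s.1 s.2.1 s.2.2)
    rw [dif_pos s.2] at this
    simpa using this
  · filter_upwards [P.eventually_mem_iff hd hp] with q hq
    rw [hq.2]
    have hfz : f q = 0 ↔ ∀ s : Fin n' × Fin m', inc s.1 s.2 → s ≠ q₀ →
        ⟪q.2 (τ.symm s.2), q.1 (σ.symm s.1)⟫ = 1 := by
      rw [funext_iff]
      exact ⟨fun h s h1 h2 => sub_eq_zero.1 (h ⟨s, h1, h2⟩),
        fun h s => sub_eq_zero.2 (h s.1 s.2.1 s.2.2)⟩
    rw [hfz]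
    constructor
    · intro h s hs _
      exact h _ _ ((hinc _ _).2 (by simpa using hs))
    · intro h i j hij
      rw [hinc] at hij
      by_cases hs : (σ i, τ j) = q₀
      · have := hred (q.1 ∘ σ.symm) (q.2 ∘ τ.symm) h
          fun i j hn => hq.1 _ _ fun hm => hn (by simpa using (hinc _ _).1 hm)
        rw [← hs] at this
        simpa using this
      · simpa using h (σ i, τ j) hij hs
  · have hn : n = n' := by simpa using Fintype.card_congr σ
    have hm : m = m' := by simpa using Fintype.card_congr τ
    subst hn hm
    rw [Module.finrank_prod, Module.finrank_fintype_fun_eq_card]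
    simp only [Module.finrank_pi_fintype, finrank_euclideanSpace_fin, Finset.sum_const,
      Finset.card_univ, Fintype.card_fin, smul_eq_mul]
    rw [← hk]
    ring

/-! ### The redundant incidence of a triangular prism -/

/-- Four points in a plane of `ℝ⁴` given by two equations are affinely dependent. -/
theorem exists_affine_relation {A B : EuclideanSpace ℝ (Fin 4)} (hAB : LinearIndependent ℝ ![A, B])
    {x : Fin 4 → EuclideanSpace ℝ (Fin 4)} (hA : ∀ i, ⟪A, x i⟫ = 1) (hB : ∀ i, ⟪B, x i⟫ = 1) :
    ∃ c : Fin 4 → ℝ, ∑ i, c i = 0 ∧ ∑ i, c i • x i = 0 ∧ c ≠ 0 := by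
  have hx : ¬ AffineIndependent ℝ x := by
    intro h
    have h1 := h.finrank_vectorSpan (n := 3) (by simp)
    let K := Submodule.span ℝ (Set.range ![A, B])
    have h2 : vectorSpan ℝ (Set.range x) ≤ Kᗮ := by
      rw [vectorSpan, Submodule.span_le]
      rintro _ ⟨_, ⟨i, rfl⟩, _, ⟨j, rfl⟩, rfl⟩
      rw [SetLike.mem_coe, Submodule.mem_orthogonal]
      intro u hu
      have hu' : u ∈ Submodule.span ℝ {A, B} := by simpa [K, Set.pair_comm] using hu
      obtain ⟨a, b, rfl⟩ := Submodule.mem_span_pair.1 hu'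
      simp [inner_add_left, inner_smul_left, inner_sub_right, hA, hB]
    have h3 := Submodule.finrank_mono h2
    have h4 := K.finrank_add_finrank_orthogonal
    have h5 : Module.finrank ℝ K = 2 := by simpa using finrank_span_eq_card hAB
    rw [finrank_euclideanSpace_fin] at h4
    omega
  rw [affineIndependent_iff_of_fintype] at hx
  push Not at hx
  obtain ⟨c, h1, h2, i, hi⟩ := hx
  refine ⟨c, h1, ?_, fun h => hi (by rw [h]; rfl)⟩
  rwa [Finset.weightedVSub_eq_linear_combination _ h1] at h2

/-- If the quadrangles `p₁ q₁ p₂ q₂` and `p₁ q₁ p₃ q₃` of a prism are planar, the lines `p₂ q₂` and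
`p₃ q₃` meet the line `p₁ q₁`, possibly at infinity. If both lie in the hyperplane `A₂₃`, which does
not contain `p₁` and `q₁`, they meet it in the same point. So every hyperplane `B₂₃` through `p₂`,
`q₂`, `p₃` contains this point, and hence `q₃`. -/
theorem prism_redundancy {p₁ q₁ p₂ q₂ p₃ q₃ A₁₂ B₁₂ A₁₃ B₁₃ A₂₃ B₂₃ : EuclideanSpace ℝ (Fin 4)}
    (h₁₂ : LinearIndependent ℝ ![A₁₂, B₁₂]) (h₁₃ : LinearIndependent ℝ ![A₁₃, B₁₃])
    (hA₁₂ : ∀ i, ⟪A₁₂, ![p₁, q₁, p₂, q₂] i⟫ = 1) (hB₁₂ : ∀ i, ⟪B₁₂, ![p₁, q₁, p₂, q₂] i⟫ = 1)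
    (hA₁₃ : ∀ i, ⟪A₁₃, ![p₁, q₁, p₃, q₃] i⟫ = 1) (hB₁₃ : ∀ i, ⟪B₁₃, ![p₁, q₁, p₃, q₃] i⟫ = 1)
    (hA₂₃ : ∀ i, ⟪A₂₃, ![p₂, q₂, p₃, q₃] i⟫ = 1) (hB₂₃ : ∀ i, ⟪B₂₃, ![p₂, q₂, p₃] i⟫ = 1)
    (hp₁ : ⟪A₂₃, p₁⟫ ≠ 1) (hq₁ : ⟪A₂₃, q₁⟫ ≠ 1) (hp₃ : ⟪A₁₂, p₃⟫ ≠ 1)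
    (hpq₁ : p₁ ≠ q₁) (hpq₂ : p₂ ≠ q₂) : ⟪B₂₃, q₃⟫ = 1 := by
  obtain ⟨c, hc0, hc, hcne⟩ := exists_affine_relation h₁₂ hA₁₂ hB₁₂
  obtain ⟨e, he0, he, hene⟩ := exists_affine_relation h₁₃ hA₁₃ hB₁₃
  simp only [Fin.sum_univ_four, Matrix.cons_val] at hc0 hc he0 he
  have key : ∀ (Y : EuclideanSpace ℝ (Fin 4)) (c : Fin 4 → ℝ) (x y z w),
      c 0 + c 1 + c 2 + c 3 = 0 → c 0 • x + c 1 • y + c 2 • z + c 3 • w = 0 →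
      c 0 * (⟪Y, x⟫ - 1) + c 1 * (⟪Y, y⟫ - 1) + c 2 * (⟪Y, z⟫ - 1) + c 3 * (⟪Y, w⟫ - 1) = 0 := by
    intro Y c x y z w h0 h
    have := congrArg (fun u => ⟪Y, u⟫) h
    simp only [inner_add_right, inner_smul_right, inner_zero_right] at this
    linear_combination this - h0
  have ha := key A₂₃ c _ _ _ _ hc0 hc
  have ha' := key A₂₃ e _ _ _ _ he0 he
  have hb := key B₂₃ c _ _ _ _ hc0 hc
  have hb' := key B₂₃ e _ _ _ _ he0 he
  have hm := key A₁₂ e _ _ _ _ he0 he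
  have hA1 : ⟪A₂₃, p₂⟫ = 1 := hA₂₃ 0
  have hA2 : ⟪A₂₃, q₂⟫ = 1 := hA₂₃ 1
  have hA3 : ⟪A₂₃, p₃⟫ = 1 := hA₂₃ 2
  have hA4 : ⟪A₂₃, q₃⟫ = 1 := hA₂₃ 3
  have hB1 : ⟪B₂₃, p₂⟫ = 1 := hB₂₃ 0
  have hB2 : ⟪B₂₃, q₂⟫ = 1 := hB₂₃ 1
  have hB3 : ⟪B₂₃, p₃⟫ = 1 := hB₂₃ 2
  have hC1 : ⟪A₁₂, p₁⟫ = 1 := hA₁₂ 0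
  have hC2 : ⟪A₁₂, q₁⟫ = 1 := hA₁₂ 1
  simp only [hA1, hA2, hA3, hA4, hB1, hB2, hB3, hC1, hC2, sub_self, mul_zero, add_zero,
    zero_add] at ha ha' hb hb' hm
  have hp₁' := sub_ne_zero.2 hp₁
  have hq₁' := sub_ne_zero.2 hq₁
  have hp₃' := sub_ne_zero.2 hp₃
  have htwo : ∀ (s t : ℝ) (x y : EuclideanSpace ℝ (Fin 4)), x ≠ y → s + t = 0 →
      s • x + t • y = 0 → s = 0 ∧ t = 0 := by
    intro s t x y hxy hst h
    obtain rfl : t = -s := by linarith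
    have h' : s • (x - y) = 0 := by rw [smul_sub]; simpa [sub_eq_add_neg] using h
    have hs : s = 0 := (smul_eq_zero.1 h').resolve_right (sub_ne_zero.2 hxy)
    simp [hs]
  -- The relation of the first quadrangle involves the line `p₁ q₁`.
  have hc01 : c 0 ≠ 0 ∧ c 1 ≠ 0 := by
    have hboth : ¬ (c 0 = 0 ∧ c 1 = 0) := by
      rintro ⟨h0, h1⟩
      rw [h0, h1] at hc hc0
      obtain ⟨h2, h3⟩ := htwo (c 2) (c 3) _ _ hpq₂ (by linarith) (by simpa using hc)
      exact hcne (funext fun i => by fin_cases i <;> assumption)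
    refine ⟨fun h => hboth ⟨h, ?_⟩, fun h => hboth ⟨?_, h⟩⟩
    · rw [h, zero_mul, zero_add] at ha
      exact (mul_eq_zero.1 ha).resolve_right hq₁'
    · rw [h, zero_mul, add_zero] at ha
      exact (mul_eq_zero.1 ha).resolve_right hp₁'
  -- The relation of the second quadrangle involves `q₃`.
  have he3 : e 3 ≠ 0 := by
    intro h3
    rw [h3, zero_mul, add_zero] at hm
    have h2 : e 2 = 0 := (mul_eq_zero.1 hm).resolve_right hp₃'
    rw [h2, h3] at he he0
    obtain ⟨h0, h1⟩ := htwo (e 0) (e 1) _ _ hpq₁ (by linarith) (by simpa using he)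
    exact hene (funext fun i => by fin_cases i <;> assumption)
  -- Both relations give the same point on the line `p₁ q₁`.
  have hprop : c 0 * e 1 = c 1 * e 0 := by
    refine mul_right_cancel₀ hq₁' ?_
    linear_combination c 0 * ha' - e 0 * ha
  have hfin : c 0 * (e 3 * (⟪B₂₃, q₃⟫ - 1)) = 0 := by
    linear_combination c 0 * hb' - e 0 * hb - (⟪B₂₃, q₁⟫ - 1) * hprop
  have := (mul_eq_zero.1 ((mul_eq_zero.1 hfin).resolve_left hc01.1)).resolve_left he3
  linarith

/-! ### Coordinates of the three polytopes -/

theorem inner_fin_four (x y : EuclideanSpace ℝ (Fin 4)) :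
    ⟪x, y⟫ = x 0 * y 0 + x 1 * y 1 + x 2 * y 2 + x 3 * y 3 := by
  simp [PiLp.inner_apply, Fin.sum_univ_four, mul_comm]

/-- The vertices of the prism and the two apices `(c, 0, 0, ±1)`. The values `1`, `0`, `2` of `c`
give the three polytopes. -/
noncomputable def apexVertices (c : ℝ) : Fin 8 → EuclideanSpace ℝ (Fin 4) :=
  ![!₂[-1, 1, 1, 0], !₂[-1, -1, 1, 0], !₂[-1, 0, -1, 0],
    !₂[1, 1, 1, 0], !₂[1, -1, 1, 0], !₂[1, 0, -1, 0],
    !₂[c, 0, 0, -1], !₂[c, 0, 0, 1]]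

/-- The vertex sets of the facets of `P₁`. In all three lists the first eight facets are those over
the quadrangles and over one triangle of the prism, alternating between the two apices. -/
def facetVertices₁ : Fin 9 → List (Fin 8) :=
  ![[0, 1, 3, 4, 6], [0, 1, 3, 4, 7], [0, 2, 3, 5, 6], [0, 2, 3, 5, 7], [1, 2, 4, 5, 6],
    [1, 2, 4, 5, 7], [0, 1, 2, 6], [0, 1, 2, 7], [3, 4, 5, 6, 7]]

/-- The vertex sets of the facets of `P₂`. -/
def facetVertices₂ : Fin 10 → List (Fin 8) :=
  ![[0, 1, 3, 4, 6], [0, 1, 3, 4, 7], [0, 2, 3, 5, 6], [0, 2, 3, 5, 7], [1, 2, 4, 5, 6],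
    [1, 2, 4, 5, 7], [0, 1, 2, 6], [0, 1, 2, 7], [3, 4, 5, 6], [3, 4, 5, 7]]

/-- The vertex sets of the facets of `P₃`. -/
def facetVertices₃ : Fin 11 → List (Fin 8) :=
  ![[0, 1, 3, 4, 6], [0, 1, 3, 4, 7], [0, 2, 3, 5, 6], [0, 2, 3, 5, 7], [1, 2, 4, 5, 6],
    [1, 2, 4, 5, 7], [0, 1, 2, 6], [0, 1, 2, 7], [3, 4, 6, 7], [3, 5, 6, 7], [4, 5, 6, 7]]

/-- The facet normals of `P₁`, scaled such that the facet inequalities are `⟪a, y⟫ ≤ 1`. -/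
noncomputable def normals₁ : Fin 9 → EuclideanSpace ℝ (Fin 4) :=
  ![!₂[0, 0, 1, -1], !₂[0, 0, 1, 1], !₂[0, 2, -1, -1], !₂[0, 2, -1, 1], !₂[0, -2, -1, -1],
    !₂[0, -2, -1, 1], !₂[-1, 0, 0, -2], !₂[-1, 0, 0, 2], !₂[1, 0, 0, 0]]

/-- The facet normals of `P₂`, scaled such that the facet inequalities are `⟪a, y⟫ ≤ 1`. -/
noncomputable def normals₂ : Fin 10 → EuclideanSpace ℝ (Fin 4) :=
  ![!₂[0, 0, 1, -1], !₂[0, 0, 1, 1], !₂[0, 2, -1, -1], !₂[0, 2, -1, 1], !₂[0, -2, -1, -1],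
    !₂[0, -2, -1, 1], !₂[-1, 0, 0, -1], !₂[-1, 0, 0, 1], !₂[1, 0, 0, -1], !₂[1, 0, 0, 1]]

/-- The facet normals of `P₃`, scaled such that the facet inequalities are `⟪a, y⟫ ≤ 1`. -/
noncomputable def normals₃ : Fin 11 → EuclideanSpace ℝ (Fin 4) :=
  ![!₂[0, 0, 1, -1], !₂[0, 0, 1, 1], !₂[0, 2, -1, -1], !₂[0, 2, -1, 1], !₂[0, -2, -1, -1],
    !₂[0, -2, -1, 1], !₂[-1, 0, 0, -3], !₂[-1, 0, 0, 3], !₂[1 / 2, 0, 1 / 2, 0],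
    !₂[1 / 2, 1, -1 / 2, 0], !₂[1 / 2, -1, -1 / 2, 0]]

theorem hasIncidences₁ : HasIncidences (fun i j => i ∈ facetVertices₁ j) vertices₁ normals₁ := by
  constructor <;> intro i j h <;> fin_cases j <;> fin_cases i <;>
    first
    | exact absurd h (by decide)
    | (simp [vertices₁, normals₁, inner_fin_four] <;> norm_num)

theorem hasIncidences₂ : HasIncidences (fun i j => i ∈ facetVertices₂ j) vertices₂ normals₂ := by
  constructor <;> intro i j h <;> fin_cases j <;> fin_cases i <;>
    first
    | exact absurd h (by decide)
    | (simp [vertices₂, normals₂, inner_fin_four] <;> norm_num)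

theorem hasIncidences₃ : HasIncidences (fun i j => i ∈ facetVertices₃ j) vertices₃ normals₃ := by
  constructor <;> intro i j h <;> fin_cases j <;> fin_cases i <;>
    first
    | exact absurd h (by decide)
    | (simp [vertices₃, normals₃, inner_fin_four] <;> norm_num)

/-- Weights for a point of the `t`-fold dilate of the prism: products of the weights along the
interval and the triangle of which the prism is the product. -/
theorem exists_prism_weights {t x y z : ℝ} (hx : -t ≤ x) (hx' : x ≤ t) (hz : z ≤ t)
    (hy : 2 * y ≤ t + z) (hy' : -2 * y ≤ t + z) :
    ∃ r : Fin 6 → ℝ, (∀ i, 0 ≤ r i) ∧ r 0 + r 1 + r 2 + r 3 + r 4 + r 5 = t ∧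
      -r 0 - r 1 - r 2 + r 3 + r 4 + r 5 = x ∧ r 0 - r 1 + r 3 - r 4 = y ∧
      r 0 + r 1 - r 2 + r 3 + r 4 - r 5 = z := by
  rcases (show 0 ≤ t by linarith).eq_or_lt with rfl | ht
  · refine ⟨0, by simp, by simp, ?_, ?_, ?_⟩ <;> simp only [Pi.zero_apply] <;> linarith
  · have h1 : 0 ≤ (t - x) / (2 * t) := div_nonneg (by linarith) (by linarith)
    have h2 : 0 ≤ (t + x) / (2 * t) := div_nonneg (by linarith) (by linarith)
    have h3 : 0 ≤ (t + z) / 4 + y / 2 := by linarith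
    have h4 : 0 ≤ (t + z) / 4 - y / 2 := by linarith
    have h5 : 0 ≤ (t - z) / 2 := by linarith
    refine ⟨![(t - x) / (2 * t) * ((t + z) / 4 + y / 2), (t - x) / (2 * t) * ((t + z) / 4 - y / 2),
      (t - x) / (2 * t) * ((t - z) / 2), (t + x) / (2 * t) * ((t + z) / 4 + y / 2),
      (t + x) / (2 * t) * ((t + z) / 4 - y / 2), (t + x) / (2 * t) * ((t - z) / 2)], ?_, ?_⟩
    · intro i
      fin_cases i
      exacts [mul_nonneg h1 h3, mul_nonneg h1 h4, mul_nonneg h1 h5, mul_nonneg h2 h3,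
        mul_nonneg h2 h4, mul_nonneg h2 h5]
    · simp only [Matrix.cons_val]
      refine ⟨?_, ?_, ?_, ?_⟩ <;> field_simp <;> ring

/-- The weights of the two apices are `α` and `β`, and `t` is the weight left for the prism. -/
theorem mem_convexHull_apexVertices {c t α β : ℝ} {y : EuclideanSpace ℝ (Fin 4)} (hα : 0 ≤ α)
    (hβ : 0 ≤ β) (hsum : t + α + β = 1) (h3 : y 3 = β - α) (hx : -t ≤ y 0 - c * (α + β))
    (hx' : y 0 - c * (α + β) ≤ t) (hz : y 2 ≤ t) (hy : 2 * y 1 ≤ t + y 2)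
    (hy' : -2 * y 1 ≤ t + y 2) : y ∈ convexHull ℝ (Set.range (apexVertices c)) := by
  obtain ⟨r, hr, h0, h1, h2, h4⟩ := exists_prism_weights hx hx' hz hy hy'
  rw [mem_convexHull_range_iff]
  refine ⟨![r 0, r 1, r 2, r 3, r 4, r 5, α, β], ?_, ?_, ?_⟩
  · intro i
    fin_cases i
    exacts [hr 0, hr 1, hr 2, hr 3, hr 4, hr 5, hα, hβ]
  · simp [Fin.sum_univ_eight]; linarith
  · ext k
    fin_cases k <;> simp [Fin.sum_univ_eight, apexVertices] <;> linarith

theorem convexHull_vertices₁ :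
    convexHull ℝ (Set.range vertices₁) = {y | ∀ j, ⟪normals₁ j, y⟫ ≤ 1} := by
  refine hasIncidences₁.range_subset.antisymm fun y hy => ?_
  have h0 := hy 0
  have h1 := hy 1
  have h2 := hy 2
  have h3 := hy 3
  have h4 := hy 4
  have h5 := hy 5
  have h6 := hy 6
  have h7 := hy 7
  have h8 := hy 8
  simp [normals₁, inner_fin_four] at h0 h1 h2 h3 h4 h5 h6 h7 h8
  rcases le_total 0 (y 3) with h | h
  · exact mem_convexHull_apexVertices (c := 1) (t := 1 - y 3) (α := 0) (β := y 3) le_rfl h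
      (by ring) (by ring) (by linarith) (by linarith) (by linarith) (by linarith) (by linarith)
  · exact mem_convexHull_apexVertices (c := 1) (t := 1 + y 3) (α := -y 3) (β := 0) (by linarith)
      le_rfl (by ring) (by ring) (by linarith) (by linarith) (by linarith) (by linarith)
      (by linarith)

theorem convexHull_vertices₂ :
    convexHull ℝ (Set.range vertices₂) = {y | ∀ j, ⟪normals₂ j, y⟫ ≤ 1} := by
  refine hasIncidences₂.range_subset.antisymm fun y hy => ?_
  have h0 := hy 0
  have h1 := hy 1
  have h2 := hy 2
  have h3 := hy 3
  have h4 := hy 4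
  have h5 := hy 5
  have h6 := hy 6
  have h7 := hy 7
  have h8 := hy 8
  have h9 := hy 9
  simp [normals₂, inner_fin_four] at h0 h1 h2 h3 h4 h5 h6 h7 h8 h9
  rcases le_total 0 (y 3) with h | h
  · exact mem_convexHull_apexVertices (c := 0) (t := 1 - y 3) (α := 0) (β := y 3) le_rfl h
      (by ring) (by ring) (by linarith) (by linarith) (by linarith) (by linarith) (by linarith)
  · exact mem_convexHull_apexVertices (c := 0) (t := 1 + y 3) (α := -y 3) (β := 0) (by linarith)
      le_rfl (by ring) (by ring) (by linarith) (by linarith) (by linarith) (by linarith)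
      (by linarith)

theorem convexHull_vertices₃ :
    convexHull ℝ (Set.range vertices₃) = {y | ∀ j, ⟪normals₃ j, y⟫ ≤ 1} := by
  refine hasIncidences₃.range_subset.antisymm fun y hy => ?_
  have h0 := hy 0
  have h1 := hy 1
  have h2 := hy 2
  have h3 := hy 3
  have h4 := hy 4
  have h5 := hy 5
  have h6 := hy 6
  have h7 := hy 7
  have h8 := hy 8
  have h9 := hy 9
  have h10 := hy 10
  simp [normals₃, inner_fin_four] at h0 h1 h2 h3 h4 h5 h6 h7 h8 h9 h10
  -- Besides the apex needed for the last coordinate, points beyond the triangle at `x = 1` also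
  -- need some weight `μ` on the midpoint `(2, 0, 0, 0)` of the two apices.
  obtain ⟨s, hs, hs'⟩ : ∃ s : ℝ, s = |y 3| ∧ (s = y 3 ∨ s = -y 3) :=
    ⟨_, rfl, abs_choice (y 3)⟩
  have hs0 : 0 ≤ s := hs ▸ abs_nonneg _
  obtain ⟨μ, hμ0, hμ1, hμ2⟩ : ∃ μ : ℝ, 0 ≤ μ ∧ y 0 - s - 1 ≤ μ ∧ (μ = 0 ∨ μ = y 0 - s - 1) := by
    rcases le_total 0 (y 0 - s - 1) with h | h
    · exact ⟨_, h, le_rfl, Or.inr rfl⟩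
    · exact ⟨0, le_rfl, h, Or.inl rfl⟩
  rcases hs' with h | h
  · refine mem_convexHull_apexVertices (c := 2) (t := 1 - s - μ) (α := μ / 2) (β := s + μ / 2)
      (by linarith) (by linarith) (by ring) (by linarith) ?_ (by linarith) ?_ ?_ ?_ <;>
    rcases hμ2 with hμ2 | hμ2 <;> linarith
  · refine mem_convexHull_apexVertices (c := 2) (t := 1 - s - μ) (α := s + μ / 2) (β := μ / 2)
      (by linarith) (by linarith) (by ring) (by linarith) ?_ (by linarith) ?_ ?_ ?_ <;>
    rcases hμ2 with hμ2 | hμ2 <;> linarith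

/-! ### Realization spaces -/

/-- The incidence of the sixth prism vertex with the sixth facet follows from the other incidences,
if the first eight facets are the six over the quadrangles and the two over the triangle `0 1 2`. -/
theorem prism_incidence_redundant {m : ℕ} (h8 : 8 ≤ m) {inc : Fin 8 → Fin m → Prop}
    (hinc : ∀ i (j : Fin 8), inc i (j.castLE h8) ↔ i ∈ facetVertices₂ (j.castLE (by decide)))
    (V : Fin 8 → EuclideanSpace ℝ (Fin 4)) (A : Fin m → EuclideanSpace ℝ (Fin 4))
    (heq : ∀ q : Fin 8 × Fin m, inc q.1 q.2 → q ≠ (5, (5 : Fin 8).castLE h8) → ⟪A q.2, V q.1⟫ = 1)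
    (hlt : ∀ i j, ¬ inc i j → ⟪A j, V i⟫ < 1) : ⟪A ((5 : Fin 8).castLE h8), V 5⟫ = 1 := by
  have h1 : ∀ i (j : Fin 8), i ∈ facetVertices₂ (j.castLE (by decide)) ∧ (i, j) ≠ (5, 5) →
      ⟪A (j.castLE h8), V i⟫ = 1 := by
    rintro i j ⟨hi, hij⟩
    refine heq (i, j.castLE h8) ((hinc i j).2 hi) fun h => hij ?_
    rw [Prod.mk.injEq] at h
    rw [h.1, Fin.castLE_injective h8 h.2]
  have h2 : ∀ i (j : Fin 8), i ∉ facetVertices₂ (j.castLE (by decide)) →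
      ⟪A (j.castLE h8), V i⟫ < 1 := fun i j hij => hlt i _ fun h => hij ((hinc i j).1 h)
  -- Two facets through vertex `0`, only one of which contains the apex `6`, are independent.
  have hpair : ∀ j k : Fin 8, (∀ i ∈ [0, 6], i ∈ facetVertices₂ (j.castLE (by decide)) ∧
      (i, j) ≠ (5, 5)) ∧ ((0 : Fin 8) ∈ facetVertices₂ (k.castLE (by decide)) ∧
      ((0 : Fin 8), k) ≠ (5, 5)) ∧ 6 ∉ facetVertices₂ (k.castLE (by decide)) →
      LinearIndependent ℝ ![A (j.castLE h8), A (k.castLE h8)] := by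
    rintro j k ⟨hj, hk0, hk6⟩
    rw [LinearIndependent.pair_iff]
    intro s t hst
    have e0 := congrArg (fun u => ⟪u, V 0⟫) hst
    have e6 := congrArg (fun u => ⟪u, V 6⟫) hst
    simp only [inner_add_left, inner_smul_left, inner_zero_left, RCLike.conj_to_real] at e0 e6
    rw [h1 0 j (hj 0 (by simp)), h1 0 k hk0] at e0
    rw [h1 6 j (hj 6 (by simp))] at e6
    have hne : ⟪A (k.castLE h8), V 6⟫ - 1 ≠ 0 := (sub_neg.2 (h2 6 k hk6)).ne
    have ht : t = 0 := (mul_eq_zero.1 (show t * (⟪A (k.castLE h8), V 6⟫ - 1) = 0 by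
      linear_combination e6 - e0)).resolve_right hne
    exact ⟨by rw [ht] at e0; linarith, ht⟩
  have hne : ∀ i k (j : Fin 8), (i ∈ facetVertices₂ (j.castLE (by decide)) ∧ (i, j) ≠ (5, 5)) ∧
      k ∉ facetVertices₂ (j.castLE (by decide)) → V i ≠ V k := by
    rintro i k j ⟨hi, hk⟩ h
    exact (h2 k j hk).ne (h ▸ h1 i j hi)
  refine prism_redundancy (p₁ := V 0) (q₁ := V 3) (p₂ := V 1) (q₂ := V 4) (p₃ := V 2)
    (hpair 0 1 (by decide)) (hpair 2 3 (by decide)) (A₂₃ := A ((4 : Fin 8).castLE h8))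
    ?_ ?_ ?_ ?_ ?_ ?_ (h2 0 4 (by decide)).ne (h2 3 4 (by decide)).ne (h2 2 0 (by decide)).ne
    (hne 0 3 6 (by decide)) (hne 1 4 6 (by decide))
  · intro i; fin_cases i
    exacts [h1 0 0 (by decide), h1 3 0 (by decide), h1 1 0 (by decide), h1 4 0 (by decide)]
  · intro i; fin_cases i
    exacts [h1 0 1 (by decide), h1 3 1 (by decide), h1 1 1 (by decide), h1 4 1 (by decide)]
  · intro i; fin_cases i
    exacts [h1 0 2 (by decide), h1 3 2 (by decide), h1 2 2 (by decide), h1 5 2 (by decide)]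
  · intro i; fin_cases i
    exacts [h1 0 3 (by decide), h1 3 3 (by decide), h1 2 3 (by decide), h1 5 3 (by decide)]
  · intro i; fin_cases i
    exacts [h1 1 4 (by decide), h1 4 4 (by decide), h1 2 4 (by decide), h1 5 4 (by decide)]
  · intro i; fin_cases i
    exacts [h1 1 5 (by decide), h1 4 5 (by decide), h1 2 5 (by decide)]

theorem numVertices_eq {d n m : ℕ} (P : LabeledPolytope d n m) : numVertices P.carrier = n := by
  rw [numVertices, ← P.range_vertex, ← Set.image_univ,
    Set.ncard_image_of_injective _ P.vertex_injective, Set.ncard_univ, Nat.card_fin]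

theorem numFacets_eq {d n m : ℕ} (P : LabeledPolytope d n m) : numFacets P.carrier = m := by
  rw [numFacets, ← P.range_facet, ← Set.image_univ,
    Set.ncard_image_of_injective _ P.facet_injective, Set.ncard_univ, Nat.card_fin]

theorem numIncidences_eq {d n m n' m' : ℕ} (P : LabeledPolytope d n m)
    {inc : Fin n' → Fin m' → Prop} [∀ i j, Decidable (inc i j)] (σ : Fin n ≃ Fin n')
    (τ : Fin m ≃ Fin m') (hinc : ∀ i j, P.vertex i ∈ P.facet j ↔ inc (σ i) (τ j)) :
    numIncidences P.carrier = Fintype.card {q : Fin n' × Fin m' // inc q.1 q.2} := by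
  rw [numIncidences, ← Nat.card_eq_fintype_card]
  have hset : {q : EuclideanSpace ℝ (Fin d) × Set (EuclideanSpace ℝ (Fin d)) |
      q.1 ∈ P.carrier.exposedPoints ℝ ∧ IsFacet P.carrier q.2 ∧ q.1 ∈ q.2} =
      (fun q : Fin n' × Fin m' => (P.vertex (σ.symm q.1), P.facet (τ.symm q.2))) ''
        {q | inc q.1 q.2} := by
    ext ⟨v, F⟩
    constructor
    · rintro ⟨hv, hF, hvF⟩
      simp only at hv hF hvF
      rw [← P.range_vertex] at hv
      obtain ⟨i, rfl⟩ := hv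
      obtain ⟨j, rfl⟩ := P.exists_facet_eq hF
      exact ⟨(σ i, τ j), (hinc i j).1 hvF, by simp⟩
    · rintro ⟨⟨i, j⟩, hij, h⟩
      simp only [Prod.mk.injEq] at h
      obtain ⟨rfl, rfl⟩ := h
      refine ⟨P.range_vertex ▸ Set.mem_range_self _, P.isFacet_facet _, ?_⟩
      exact (hinc _ _).2 (by simpa using hij)
  rw [hset, Set.ncard_image_of_injective]
  · rfl
  · rintro ⟨i, j⟩ ⟨k, l⟩ h
    simp only [Prod.mk.injEq] at h ⊢
    exact ⟨σ.symm.injective (P.vertex_injective h.1), τ.symm.injective (P.facet_injective h.2)⟩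

/-- A polytope with the combinatorial type of a polytope in standard position has a centered
realization. -/
theorem centeredRealizationSpace_nonempty {d n m n' m' : ℕ} (hd : 0 < d)
    (P : LabeledPolytope d n m) {inc : Fin n' → Fin m' → Prop} (σ : Fin n ≃ Fin n')
    (τ : Fin m ≃ Fin m') (hinc : ∀ i j, P.vertex i ∈ P.facet j ↔ inc (σ i) (τ j))
    {V : Fin n' → EuclideanSpace ℝ (Fin d)} {A : Fin m' → EuclideanSpace ℝ (Fin d)}
    (h : HasIncidences inc V A)
    (hconv : convexHull ℝ (Set.range V) = {y | ∀ j, ⟪A j, y⟫ ≤ 1}) :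
    P.centeredRealizationSpace.Nonempty := by
  refine ⟨(V ∘ σ, A ∘ τ), P.mem_centeredRealizationSpace hd
    ⟨fun i j hij => h.eq _ _ ((hinc i j).1 hij), fun i j hij => h.lt _ _ fun hn =>
      hij ((hinc i j).2 hn)⟩ ?_⟩
  simp only [σ.surjective.range_comp, hconv, Function.comp_apply]
  ext y
  exact τ.surjective.forall (p := fun j => ⟪A j, y⟫ ≤ 1)

/-- Everything about a combinatorial type that follows from one centered polytope of this type, an
elimination sequence that leaves out one incidence, and the redundancy of this incidence. -/
theorem realization_of_combEquiv {n' m' : ℕ} {inc : Fin n' → Fin m' → Prop}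
    [∀ i j, Decidable (inc i j)] {V : Fin n' → EuclideanSpace ℝ (Fin 4)}
    {A : Fin m' → EuclideanSpace ℝ (Fin 4)} (h : HasIncidences inc V A)
    (hconv : convexHull ℝ (Set.range V) = {y | ∀ j, ⟪A j, y⟫ ≤ 1})
    (hsep : ∀ i k, i ≠ k → ∃ j, inc i j ∧ ¬ inc k j)
    (hfac : ∀ j k, j ≠ k → ∃ i, inc i j ∧ ¬ inc i k) {q₀ : Fin n' × Fin m'}
    {L : List ((Fin n' × List (Fin m')) ⊕ (Fin m' × List (Fin n')))} (hL : IsElimination inc L)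
    (hcov : ∀ q : Fin n' × Fin m', inc q.1 q.2 → q ≠ q₀ → q ∈ eliminated L)
    (hred : ∀ (V : Fin n' → EuclideanSpace ℝ (Fin 4)) (A : Fin m' → EuclideanSpace ℝ (Fin 4)),
      (∀ q : Fin n' × Fin m', inc q.1 q.2 → q ≠ q₀ → ⟪A q.2, V q.1⟫ = 1) →
      (∀ i j, ¬ inc i j → ⟪A j, V i⟫ < 1) → ⟪A q₀.2, V q₀.1⟫ = 1) {k N : ℕ}
    (hN : Fintype.card {q : Fin n' × Fin m' // inc q.1 q.2} = N)
    (hk : 4 * (n' + m') = Fintype.card {q : Fin n' × Fin m' // inc q.1 q.2 ∧ q ≠ q₀} + k)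
    {n m : ℕ} (P : LabeledPolytope 4 n m)
    (hP : CombEquiv P.carrier (convexHull ℝ (Set.range V))) :
    n = n' ∧ m = m' ∧ numIncidences P.carrier = N ∧
      naturalGuess P.carrier = 4 * (n' + m') - N ∧
      P.centeredRealizationSpace.Nonempty ∧ IsSmoothSubmanifold k P.centeredRealizationSpace := by
  obtain ⟨Q, hv, hc, -, hQ⟩ := h.exists_labeledPolytope (by norm_num) hconv hsep hfac
  have hPQ : CombEquiv P.carrier Q.carrier := by rwa [hc, ← hconv]
  obtain ⟨σ, τ, hστ⟩ := P.exists_relabeling (by norm_num) Q hPQ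
  have hinc : ∀ i j, P.vertex i ∈ P.facet j ↔ inc (σ i) (τ j) := fun i j =>
    (hστ i j).trans (hQ _ _)
  have hn : n = n' := by simpa using Fintype.card_congr σ
  have hm : m = m' := by simpa using Fintype.card_congr τ
  have hI : numIncidences P.carrier = N := (numIncidences_eq P σ τ hinc).trans hN
  refine ⟨hn, hm, hI, ?_, centeredRealizationSpace_nonempty (by norm_num) P σ τ hinc h hconv,
    P.isSmoothSubmanifold (by norm_num) σ τ hinc hL hcov hred hk⟩
  rw [naturalGuess, numVertices_eq, numFacets_eq, hI, hn, hm]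
  norm_num

/-- An elimination sequence for the incidences of the first eight facets, where the incidence of
vertex `5` and facet `5` is left out. The part `M` takes care of the two apices and of the remaining
facets. -/
def prismElimination {m : ℕ} (h : 8 ≤ m)
    (M : List ((Fin 8 × List (Fin m)) ⊕ (Fin m × List (Fin 8)))) :
    List ((Fin 8 × List (Fin m)) ⊕ (Fin m × List (Fin 8))) :=
  let f (j : Fin 8) : Fin m := j.castLE h
  [.inr (f 6, [6, 2, 1, 0]), .inr (f 7, [7, 2, 1, 0])] ++ M ++
    [.inl (5, [f 4, f 2, f 3]), .inr (f 2, [2, 3, 0]), .inr (f 3, [2, 3, 0]),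
      .inr (f 4, [2, 4, 1]), .inr (f 5, [2, 4, 1]), .inl (0, [f 0, f 1]), .inl (3, [f 0, f 1]),
      .inl (1, [f 0, f 1]), .inl (4, [f 0, f 1])]

theorem realization₁ {n m : ℕ} (P : LabeledPolytope 4 n m) (hP : CombEquiv P.carrier P₁) :
    n = 8 ∧ m = 9 ∧ numIncidences P.carrier = 43 ∧ naturalGuess P.carrier = 25 ∧
      P.centeredRealizationSpace.Nonempty ∧ IsSmoothSubmanifold 26 P.centeredRealizationSpace :=
  realization_of_combEquiv hasIncidences₁ convexHull_vertices₁ (by decide) (by decide)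
    (q₀ := (5, 5)) (L := prismElimination (by norm_num)
      [.inl (6, [0, 2, 4, 8]), .inl (7, [1, 3, 5, 8]), .inr (8, [3, 4, 5])]) (by decide) (by decide)
    (prism_incidence_redundant (inc := fun i j => i ∈ facetVertices₁ j) (by norm_num)
      (by decide)) (N := 43) (by decide) (by decide) P hP

theorem realization₂ {n m : ℕ} (P : LabeledPolytope 4 n m) (hP : CombEquiv P.carrier P₂) :
    n = 8 ∧ m = 10 ∧ numIncidences P.carrier = 46 ∧ naturalGuess P.carrier = 26 ∧
      P.centeredRealizationSpace.Nonempty ∧ IsSmoothSubmanifold 27 P.centeredRealizationSpace :=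
  realization_of_combEquiv hasIncidences₂ convexHull_vertices₂ (by decide) (by decide)
    (q₀ := (5, 5)) (L := prismElimination (by norm_num)
      [.inr (8, [6, 5, 4, 3]), .inr (9, [7, 5, 4, 3]), .inl (6, [0, 2, 4]), .inl (7, [1, 3, 5])])
    (by decide) (by decide)
    (prism_incidence_redundant (inc := fun i j => i ∈ facetVertices₂ j) (by norm_num)
      (by decide)) (N := 46) (by decide) (by decide) P hP

theorem realization₃ {n m : ℕ} (P : LabeledPolytope 4 n m) (hP : CombEquiv P.carrier P₃) :
    n = 8 ∧ m = 11 ∧ numIncidences P.carrier = 50 ∧ naturalGuess P.carrier = 26 ∧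
      P.centeredRealizationSpace.Nonempty ∧ IsSmoothSubmanifold 27 P.centeredRealizationSpace :=
  realization_of_combEquiv hasIncidences₃ convexHull_vertices₃ (by decide) (by decide)
    (q₀ := (5, 5)) (L := prismElimination (by norm_num)
      [.inr (8, [6, 7, 4, 3]), .inr (9, [6, 7, 5, 3]), .inr (10, [6, 7, 5, 4]),
        .inl (6, [0, 2, 4]), .inl (7, [1, 3, 5])]) (by decide) (by decide)
    (prism_incidence_redundant (inc := fun i j => i ∈ facetVertices₃ j) (by norm_num)
      (by decide)) (N := 50) (by decide) (by decide) P hP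

theorem exists_labeledPolytope_of_hasIncidences {n m : ℕ} {inc : Fin n → Fin m → Prop}
    {V : Fin n → EuclideanSpace ℝ (Fin 4)}
    {A : Fin m → EuclideanSpace ℝ (Fin 4)} (h : HasIncidences inc V A)
    (hconv : convexHull ℝ (Set.range V) = {y | ∀ j, ⟪A j, y⟫ ≤ 1})
    (hsep : ∀ i k, i ≠ k → ∃ j, inc i j ∧ ¬ inc k j)
    (hfac : ∀ j k, j ≠ k → ∃ i, inc i j ∧ ¬ inc i k) :
    ∃ P : LabeledPolytope 4 n m, P.carrier = convexHull ℝ (Set.range V) ∧ P.vertex = V := by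
  obtain ⟨Q, hv, hc, -, -⟩ := h.exists_labeledPolytope (by norm_num) hconv hsep hfac
  exact ⟨Q, hc.trans hconv.symm, hv⟩

/-! ### The constructions by adding a point to a pyramid -/

/-- The vertices of the triangular prism. -/
noncomputable def prismVertices : Fin 6 → EuclideanSpace ℝ (Fin 4) :=
  ![!₂[-1, 1, 1, 0], !₂[-1, -1, 1, 0], !₂[-1, 0, -1, 0],
    !₂[1, 1, 1, 0], !₂[1, -1, 1, 0], !₂[1, 0, -1, 0]]

/-- The vertices of the pyramid over the prism with apex `(c, 0, 0, -1)`. -/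
noncomputable def pyramidVertices (c : ℝ) : Fin 7 → EuclideanSpace ℝ (Fin 4) :=
  ![!₂[-1, 1, 1, 0], !₂[-1, -1, 1, 0], !₂[-1, 0, -1, 0],
    !₂[1, 1, 1, 0], !₂[1, -1, 1, 0], !₂[1, 0, -1, 0], !₂[c, 0, 0, -1]]

/-- The facet normals of the pyramid; the first facet is the prism. -/
noncomputable def pyramidNormals (c : ℝ) : Fin 6 → EuclideanSpace ℝ (Fin 4) :=
  ![!₂[0, 0, 0, 1], !₂[0, 0, 1, -1], !₂[0, 2, -1, -1], !₂[0, -2, -1, -1], !₂[1, 0, 0, c - 1],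
    !₂[-1, 0, 0, -(1 + c)]]

/-- The right-hand sides of the facet inequalities of the pyramid. -/
noncomputable def pyramidBounds : Fin 6 → ℝ := ![0, 1, 1, 1, 1, 1]

/-- The triangular prism. -/
noncomputable def prism : Set (EuclideanSpace ℝ (Fin 4)) := convexHull ℝ (Set.range prismVertices)

/-- The pyramid over the prism. -/
noncomputable def pyramid (c : ℝ) : Set (EuclideanSpace ℝ (Fin 4)) :=
  convexHull ℝ (Set.range (pyramidVertices c))

/-- The facet of the pyramid spanned by the apex and the triangle with first coordinate `1`. -/
noncomputable def pyramidSimplex (c : ℝ) : Set (EuclideanSpace ℝ (Fin 4)) :=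
  convexHull ℝ (Set.range ![!₂[1, 1, 1, 0], !₂[1, -1, 1, 0], !₂[1, 0, -1, 0], !₂[c, 0, 0, -1]])

theorem pyramidNormals_le (c : ℝ) (i : Fin 7) (j : Fin 6) :
    ⟪pyramidNormals c j, pyramidVertices c i⟫ ≤ pyramidBounds j := by
  fin_cases j <;> fin_cases i <;>
    simp [pyramidNormals, pyramidVertices, pyramidBounds, inner_fin_four] <;> norm_num

theorem pyramid_eq (c : ℝ) :
    pyramid c = {y | ∀ j, ⟪pyramidNormals c j, y⟫ ≤ pyramidBounds j} := by
  apply Set.Subset.antisymm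
  · refine convexHull_min ?_ (convex_halfspaces _ _)
    rintro _ ⟨i, rfl⟩ j
    exact pyramidNormals_le c i j
  · intro y hy
    have h0 := hy 0
    have h1 := hy 1
    have h2 := hy 2
    have h3 := hy 3
    have h4 := hy 4
    have h5 := hy 5
    simp [pyramidNormals, pyramidBounds, inner_fin_four] at h0 h1 h2 h3 h4 h5
    obtain ⟨r, hr, e0, e1, e2, e3⟩ := exists_prism_weights (t := 1 + y 3) (x := y 0 + c * y 3)
      (y := y 1) (z := y 2) (by linarith) (by linarith) (by linarith) (by linarith) (by linarith)
    rw [pyramid, mem_convexHull_range_iff]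
    refine ⟨![r 0, r 1, r 2, r 3, r 4, r 5, -y 3], ?_, ?_, ?_⟩
    · intro i
      fin_cases i
      exacts [hr 0, hr 1, hr 2, hr 3, hr 4, hr 5, neg_nonneg.2 h0]
    · simp [Fin.sum_univ_seven]; linarith
    · ext k
      fin_cases k <;> simp [Fin.sum_univ_seven, pyramidVertices] <;> linarith

theorem prism_eq_face (c : ℝ) :
    prism = {y ∈ pyramid c | innerSL ℝ (pyramidNormals c 0) y = 0} := by
  rw [pyramid, face_eq_convexHull (fun i => by
    have := pyramidNormals_le c i 0
    simpa [pyramidBounds] using this), prism]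
  have : {i | innerSL ℝ (pyramidNormals c 0) (pyramidVertices c i) = 0} =
      {0, 1, 2, 3, 4, 5} := by
    ext i
    fin_cases i <;> simp [pyramidNormals, pyramidVertices, inner_fin_four]
  rw [this]
  congr 1
  ext y
  simp only [Set.image_insert_eq, Set.image_singleton, prismVertices, pyramidVertices,
    Matrix.range_cons, Matrix.range_empty, Set.union_empty, Set.mem_union, Set.mem_insert_iff,
    Set.mem_singleton_iff, Matrix.cons_val]

theorem pyramidSimplex_eq_face (c : ℝ) :
    pyramidSimplex c = {y ∈ pyramid c | innerSL ℝ (pyramidNormals c 4) y = 1} := by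
  rw [pyramid, face_eq_convexHull (fun i => by
    have := pyramidNormals_le c i 4
    simpa [pyramidBounds] using this), pyramidSimplex]
  have : {i | innerSL ℝ (pyramidNormals c 4) (pyramidVertices c i) = 1} = {3, 4, 5, 6} := by
    ext i
    fin_cases i <;> simp [pyramidNormals, pyramidVertices, inner_fin_four] <;> norm_num
  rw [this]
  congr 1
  ext y
  simp only [Set.image_insert_eq, Set.image_singleton, pyramidVertices, Matrix.range_cons,
    Matrix.range_empty, Set.union_empty, Set.mem_union, Set.mem_insert_iff,
    Set.mem_singleton_iff, Matrix.cons_val]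

theorem affineIndependent_pyramidSimplex (c : ℝ) : AffineIndependent ℝ
    (![!₂[1, 1, 1, 0], !₂[1, -1, 1, 0], !₂[1, 0, -1, 0], !₂[c, 0, 0, -1]] :
      Fin 4 → EuclideanSpace ℝ (Fin 4)) := by
  rw [affineIndependent_iff_of_fintype]
  intro w hw h
  rw [Finset.weightedVSub_eq_linear_combination _ hw] at h
  have h1 := congrArg (fun y : EuclideanSpace ℝ (Fin 4) => y 1) h
  have h2 := congrArg (fun y : EuclideanSpace ℝ (Fin 4) => y 2) h
  have h3 := congrArg (fun y : EuclideanSpace ℝ (Fin 4) => y 3) h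
  simp [Fin.sum_univ_four] at hw h1 h2 h3
  intro i
  fin_cases i <;> simp <;> linarith

theorem isTetrahedron_pyramidSimplex (c : ℝ) : IsTetrahedron (pyramidSimplex c) :=
  ⟨_, affineIndependent_pyramidSimplex c, rfl⟩

theorem isFacet_pyramidSimplex (c : ℝ) : IsFacet (pyramid c) (pyramidSimplex c) := by
  refine ⟨?_, ?_, ?_⟩
  · rw [pyramidSimplex_eq_face]
    refine isExposed_of_le fun y hy => ?_
    rw [pyramid_eq] at hy
    have := hy 4
    simpa [pyramidBounds] using this
  · exact convexHull_nonempty_iff.2 (Set.range_nonempty _)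
  · rw [← direction_affineSpan, pyramidSimplex, affineSpan_convexHull, direction_affineSpan,
      (affineIndependent_pyramidSimplex c).finrank_vectorSpan (n := 3) (by simp)]

theorem fourth_coordinate_of_mem_affineSpan {y : EuclideanSpace ℝ (Fin 4)}
    (hy : y ∈ affineSpan ℝ prism) : y 3 = 0 := by
  rw [prism, affineSpan_convexHull] at hy
  let K : AffineSubspace ℝ (EuclideanSpace ℝ (Fin 4)) :=
    (EuclideanSpace.proj (3 : Fin 4) :
      EuclideanSpace ℝ (Fin 4) →L[ℝ] ℝ).toLinearMap.ker.toAffineSubspace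
  have hK : affineSpan ℝ (Set.range prismVertices) ≤ K := by
    rw [affineSpan_le]
    rintro _ ⟨i, rfl⟩
    fin_cases i <;> simp [K, prismVertices]
  simpa [K] using hK hy

theorem isTriangularPrism_prism : IsTriangularPrism prism := by
  refine ⟨![!₂[-1, 1, 1, 0], !₂[-1, -1, 1, 0], !₂[-1, 0, -1, 0]], !₂[2, 0, 0, 0], ?_, ?_, ?_⟩
  · rw [affineIndependent_iff_of_fintype]
    intro w hw h
    rw [Finset.weightedVSub_eq_linear_combination _ hw] at h
    have h1 := congrArg (fun y : EuclideanSpace ℝ (Fin 4) => y 1) h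
    have h2 := congrArg (fun y : EuclideanSpace ℝ (Fin 4) => y 2) h
    simp [Fin.sum_univ_three] at hw h1 h2
    intro i
    fin_cases i <;> simp <;> linarith
  · intro h
    have := vectorSpan_le_ker (d := 4) (l := EuclideanSpace.proj (0 : Fin 4)) (c := -1)
      (by rintro _ ⟨i, rfl⟩; fin_cases i <;> simp) h
    simp at this
  · rw [prism]
    congr 1
    ext y
    have e : ∀ a b c d : ℝ, (!₂[a, b, c, d] : EuclideanSpace ℝ (Fin 4)) + !₂[2, 0, 0, 0] =
        !₂[a + 2, b, c, d] := fun a b c d => by ext k; fin_cases k <;> simp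
    simp only [prismVertices, Set.mem_range, Fin.exists_fin_succ, Set.mem_union]
    simp [e]
    norm_num
    tauto

theorem range_pyramidVertices (c : ℝ) :
    Set.range (pyramidVertices c) = insert !₂[c, 0, 0, -1] (Set.range prismVertices) := by
  ext y
  simp only [pyramidVertices, prismVertices, Matrix.range_cons, Matrix.range_empty,
    Set.union_empty, Set.mem_union, Set.mem_insert_iff, Set.mem_singleton_iff]
  tauto

theorem range_apexVertices (c : ℝ) :
    Set.range (apexVertices c) = insert !₂[c, 0, 0, 1] (Set.range (pyramidVertices c)) := by
  ext y
  simp only [pyramidVertices, apexVertices, Matrix.range_cons, Matrix.range_empty,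
    Set.union_empty, Set.mem_union, Set.mem_insert_iff, Set.mem_singleton_iff]
  tauto

theorem convexHull_insert_convexHull {E : Type*} [AddCommGroup E] [Module ℝ E] (x : E)
    (s : Set E) : convexHull ℝ (insert x (convexHull ℝ s)) = convexHull ℝ (insert x s) := by
  rw [Set.insert_eq, Set.insert_eq, convexHull_convexHull_union_right]

theorem isPyramid_pyramid (c : ℝ) : IsPyramid (pyramid c) prism !₂[c, 0, 0, -1] := by
  refine ⟨fun h => ?_, ?_⟩
  · have := fourth_coordinate_of_mem_affineSpan h
    simp at this
  · rw [pyramid, range_pyramidVertices, prism, convexHull_insert_convexHull]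

theorem convexHull_apexVertices (c : ℝ) : convexHull ℝ (Set.range (apexVertices c)) =
    convexHull ℝ (insert !₂[c, 0, 0, 1] (pyramid c)) := by
  rw [pyramid, convexHull_insert_convexHull, range_apexVertices]

theorem isBeyond_prism (c : ℝ) : IsBeyond (pyramid c) prism !₂[c, 0, 0, 1] := by
  refine ⟨innerSL ℝ (pyramidNormals c 0), 0, fun y hy => ?_, prism_eq_face c, ?_⟩
  · rw [pyramid_eq] at hy
    have := hy 0
    simpa [pyramidBounds] using this
  · simp [pyramidNormals, inner_fin_four]

/-- Each facet of the pyramid is the prism, or the distinguished simplex, or the new point lies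
beneath it. For `c < 1` the new point also lies beneath the simplex. -/
theorem isBeneath_of_isFacet {c : ℝ} (hc : 0 ≤ c) {F : Set (EuclideanSpace ℝ (Fin 4))}
    (hF : IsFacet (pyramid c) F) (hQ : F ≠ prism) (hS : 1 ≤ c → F ≠ pyramidSimplex c) :
    IsBeneath (pyramid c) F !₂[c, 0, 0, 1] := by
  have hint : ∃ y, ∀ j, ⟪pyramidNormals c j, y⟫ < pyramidBounds j := by
    refine ⟨!₂[c / 2, 0, 0, -1 / 2], fun j => ?_⟩
    fin_cases j <;> simp [pyramidNormals, pyramidBounds, inner_fin_four] <;> linarith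
  have hF' := hF
  rw [pyramid_eq] at hF'
  obtain ⟨j, hj⟩ := exists_eq_of_isFacet hint hF'
  have hle : ∀ y ∈ pyramid c, innerSL ℝ (pyramidNormals c j) y ≤ pyramidBounds j := by
    intro y hy
    rw [pyramid_eq] at hy
    exact hy j
  have hFj : F = {y ∈ pyramid c | innerSL ℝ (pyramidNormals c j) y = pyramidBounds j} := by
    rw [hj, pyramid_eq]
    rfl
  refine ⟨innerSL ℝ (pyramidNormals c j), pyramidBounds j, hle, hFj, ?_⟩
  fin_cases j
  · exact absurd (hFj.trans (prism_eq_face c).symm) hQ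
  · simp [pyramidNormals, pyramidBounds, inner_fin_four]
  · simp [pyramidNormals, pyramidBounds, inner_fin_four]
  · simp [pyramidNormals, pyramidBounds, inner_fin_four]
  · have hc1 : c < 1 := by
      by_contra! h
      exact hS h (hFj.trans (pyramidSimplex_eq_face c).symm)
    simp [pyramidNormals, pyramidBounds, inner_fin_four]
    linarith
  · simp [pyramidNormals, pyramidBounds, inner_fin_four]
    linarith

theorem isConstructionOne_P₁ : IsConstructionOne P₁ := by
  refine ⟨pyramid 1, prism, pyramidSimplex 1, !₂[1, 0, 0, -1], !₂[1, 0, 0, 1],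
    isTriangularPrism_prism, isPyramid_pyramid 1, isFacet_pyramidSimplex 1,
    isTetrahedron_pyramidSimplex 1, isBeyond_prism 1, ?_,
    fun F hF hQ hS => isBeneath_of_isFacet zero_le_one hF hQ fun _ => hS,
    convexHull_apexVertices 1⟩
  -- The new point is the reflection of the apex in the center of the triangle.
  have ha : (!₂[1, 0, 0, -1] : EuclideanSpace ℝ (Fin 4)) ∈ pyramidSimplex 1 :=
    subset_convexHull ℝ _ ⟨3, rfl⟩
  have hm : (!₂[1, 0, 0, 0] : EuclideanSpace ℝ (Fin 4)) ∈ pyramidSimplex 1 := by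
    rw [pyramidSimplex, mem_convexHull_range_iff]
    refine ⟨![1 / 4, 1 / 4, 1 / 2, 0], fun i => ?_, ?_, ?_⟩
    · fin_cases i <;> simp
    · simp [Fin.sum_univ_four]; norm_num
    · ext k
      fin_cases k <;> simp [Fin.sum_univ_four] <;> norm_num
  have h := AffineMap.lineMap_mem (2 : ℝ) (subset_affineSpan ℝ _ ha) (subset_affineSpan ℝ _ hm)
  convert h using 1
  ext k
  fin_cases k <;> simp [AffineMap.lineMap_apply]
  norm_num

theorem isConstructionTwo_P₂ : IsConstructionTwo P₂ :=
  ⟨pyramid 0, prism, !₂[0, 0, 0, -1], !₂[0, 0, 0, 1], isTriangularPrism_prism,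
    isPyramid_pyramid 0, isBeyond_prism 0, fun F hF hQ => isBeneath_of_isFacet le_rfl hF hQ
      fun h => absurd h (by norm_num), convexHull_apexVertices 0⟩

theorem isConstructionThree_P₃ : IsConstructionThree P₃ := by
  refine ⟨pyramid 2, prism, pyramidSimplex 2, !₂[2, 0, 0, -1], !₂[2, 0, 0, 1],
    isTriangularPrism_prism, isPyramid_pyramid 2, isFacet_pyramidSimplex 2,
    isTetrahedron_pyramidSimplex 2, isBeyond_prism 2, ?_,
    fun F hF hQ hS => isBeneath_of_isFacet zero_le_two hF hQ fun _ => hS,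
    convexHull_apexVertices 2⟩
  refine ⟨innerSL ℝ (pyramidNormals 2 4), 1, fun y hy => ?_, pyramidSimplex_eq_face 2, ?_⟩
  · rw [pyramid_eq] at hy
    have := hy 4
    simpa [pyramidBounds] using this
  · simp [pyramidNormals, inner_fin_four]
    norm_num

theorem zero_mem_intrinsicInterior_prism :
    (0 : EuclideanSpace ℝ (Fin 4)) ∈ intrinsicInterior ℝ prism := by
  have hmem : ∀ y : EuclideanSpace ℝ (Fin 4), y 3 = 0 →
      (∀ j : Fin 6, j ≠ 0 → ⟪pyramidNormals 0 j, y⟫ < 1) → y ∈ prism := by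
    intro y hy h
    rw [prism_eq_face 0, pyramid_eq]
    refine ⟨fun j => ?_, ?_⟩
    · by_cases hj : j = 0
      · subst hj
        simp [pyramidNormals, pyramidBounds, inner_fin_four, hy]
      · have : pyramidBounds j = 1 := by fin_cases j <;> first | rfl | exact absurd rfl hj
        rw [this]
        exact (h j hj).le
    · simp [pyramidNormals, inner_fin_four, hy]
  have h0 : (0 : EuclideanSpace ℝ (Fin 4)) ∈ prism := hmem 0 rfl (by simp)
  rw [mem_intrinsicInterior]
  refine ⟨⟨0, subset_affineSpan ℝ _ h0⟩, ?_, rfl⟩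
  rw [mem_interior_iff_mem_nhds]
  have hev : ∀ᶠ y : affineSpan ℝ prism in nhds ⟨0, subset_affineSpan ℝ _ h0⟩,
      ∀ j : Fin 6, j ≠ 0 → ⟪pyramidNormals 0 j, (y : EuclideanSpace ℝ (Fin 4))⟫ < 1 := by
    rw [Filter.eventually_all]
    intro j
    have hc : Continuous fun y : affineSpan ℝ prism =>
        ⟪pyramidNormals 0 j, (y : EuclideanSpace ℝ (Fin 4))⟫ := by fun_prop
    have := hc.continuousAt (x := ⟨0, subset_affineSpan ℝ _ h0⟩) |>.eventually_lt
      (continuousAt_const (y := (1 : ℝ))) (by simp)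
    exact this.mono fun y hy _ => hy
  filter_upwards [hev] with y hy
  exact hmem y (fourth_coordinate_of_mem_affineSpan y.2) hy

theorem isBipyramid_P₂ : IsBipyramid P₂ prism := by
  refine ⟨!₂[0, 0, 0, -1], !₂[0, 0, 0, 1], fun h => ?_, ⟨0, ?_, zero_mem_intrinsicInterior_prism⟩,
    ?_⟩
  · have := fourth_coordinate_of_mem_affineSpan h
    simp at this
  · refine ⟨1 / 2, 1 / 2, by norm_num, by norm_num, by norm_num, ?_⟩
    ext k
    fin_cases k <;> simp
  · rw [prism, convexHull_convexHull_union_left]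
    have h : Set.range vertices₂ = Set.range prismVertices ∪ {!₂[0, 0, 0, -1], !₂[0, 0, 0, 1]} := by
      have := range_apexVertices 0
      rw [range_pyramidVertices] at this
      rw [show vertices₂ = apexVertices 0 from rfl, this, Set.union_comm]
      ext y
      simp only [Set.mem_insert_iff, Set.mem_union, Set.mem_singleton_iff]
      tauto
    rw [P₂, h]

end PolytopeRealization

theorem mainTheorem7 :
    -- `P₁`, `P₂`, `P₃` are `4`-polytopes with the given eight points as vertices,
    -- with 9, 10, 11 facets, and they arise by the three constructions
    ((∃ P : LabeledPolytope 4 8 9, P.carrier = P₁ ∧ P.vertex = vertices₁) ∧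
      IsConstructionOne P₁) ∧
    ((∃ P : LabeledPolytope 4 8 10, P.carrier = P₂ ∧ P.vertex = vertices₂) ∧
      IsConstructionTwo P₂ ∧ ∃ Q, IsTriangularPrism Q ∧ IsBipyramid P₂ Q) ∧
    ((∃ P : LabeledPolytope 4 8 11, P.carrier = P₃ ∧ P.vertex = vertices₃) ∧
      IsConstructionThree P₃) ∧
    -- realization spaces and natural guesses of all polytopes of these combinatorial types
    (∀ (n m : ℕ) (P : LabeledPolytope 4 n m), CombEquiv P.carrier P₁ →
      n = 8 ∧ m = 9 ∧ numIncidences P.carrier = 43 ∧ naturalGuess P.carrier = 25 ∧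
      P.centeredRealizationSpace.Nonempty ∧ IsSmoothSubmanifold 26 P.centeredRealizationSpace) ∧
    (∀ (n m : ℕ) (P : LabeledPolytope 4 n m), CombEquiv P.carrier P₂ →
      n = 8 ∧ m = 10 ∧ numIncidences P.carrier = 46 ∧ naturalGuess P.carrier = 26 ∧
      P.centeredRealizationSpace.Nonempty ∧ IsSmoothSubmanifold 27 P.centeredRealizationSpace) ∧
    (∀ (n m : ℕ) (P : LabeledPolytope 4 n m), CombEquiv P.carrier P₃ →
      n = 8 ∧ m = 11 ∧ numIncidences P.carrier = 50 ∧ naturalGuess P.carrier = 26 ∧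
      P.centeredRealizationSpace.Nonempty ∧
      IsSmoothSubmanifold 27 P.centeredRealizationSpace) := by
  refine ⟨⟨?_, isConstructionOne_P₁⟩, ⟨?_, isConstructionTwo_P₂, prism, isTriangularPrism_prism,
    isBipyramid_P₂⟩, ⟨?_, isConstructionThree_P₃⟩, fun n m P => realization₁ P,
    fun n m P => realization₂ P, fun n m P => realization₃ P⟩
  · exact exists_labeledPolytope_of_hasIncidences hasIncidences₁ convexHull_vertices₁ (by decide)
      (by decide)
  · exact exists_labeledPolytope_of_hasIncidences hasIncidences₂ convexHull_vertices₂ (by decide)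
      (by decide)
  · exact exists_labeledPolytope_of_hasIncidences hasIncidences₃ convexHull_vertices₃ (by decide)
      (by decide)
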